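/- Let $\Lambda$ be an Artin algebra (an algebra that is finitely generated as a module over a commutative artinian ring $R$), and let $n \ge 0$ be an integer. Modules are left modules. Suppose that $\Lambda$ is a minimal $n$-Auslander-Gorenstein algebra, that is, $\operatorname{id} {}_\Lambda\Lambda \le n+1 \le \operatorname{domdim}\Lambda$, where $\operatorname{id}$ is the injective dimension and $\operatorname{domdim}\Lambda$ is the supremum of all $d$ such that the first $d$ terms $I^0,\dots,I^{d-1}$ of a minimal injective coresolution $0\to\Lambda\to I^0\to I^1\to\cdots$ of the left module $\Lambda$ are projective. A finitely generated module is Gorenstein projective if it is isomorphic to the module of $0$-cocycles of an exact complex $P^\bullet$ of finitely generated projective modules for which $\operatorname{Hom}_\Lambda(P^\bullet,\Lambda)$ is also exact; $\operatorname{Gpd} N$ is the least $m\ge 0$ for which there is an exact sequence $0\to G_m\to\cdots\to G_0\to N\to 0$ with all $G_i$ Gorenstein projective (and $\infty$ if there is none). The socle $\operatorname{soc} N$ is the sum of the simple submodules of $N$. Then for every finitely generated $\Lambda$-module $N$ the following are equivalent: 1. $\operatorname{Gpd} N \le n$; 2. $\operatorname{Gpd}(\operatorname{soc} N) \le n$;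 3. $N$ is cogenerated by a finite direct sum of copies of $\Lambda$, that is, there is an injective homomorphism $N \to \Lambda^m$ for some $m \ge 0$. In other words, writing $\operatorname{GP}^{\le n}(\Lambda)$ for the class of finitely generated modules $N$ with $\operatorname{Gpd} N\le n$ and $\operatorname{sub}\Lambda$ for the class of finitely generated modules satisfying (3), one has $\operatorname{GP}^{\le n}(\Lambda) = \{N \text{ finitely generated} : \operatorname{Gpd}(\operatorname{soc} N)\le n\} = \operatorname{sub}\Lambda$. -/

import Mathlib

open CategoryTheory

universe u v

namespace AuslanderGorenstein

/-- A submodule `K` of `M` is essential if it meets every nonzero submodule of `M` nontrivially. -/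
def IsEssential {Λ : Type u} [Ring Λ] {M : Type u} [AddCommGroup M] [Module Λ M]
    (K : Submodule Λ M) : Prop :=
  ∀ L : Submodule Λ M, K ⊓ L = ⊥ → L = ⊥

/-- An injective coresolution `0 → M → I⁰ → I¹ → ⋯` is minimal if `Iʲ` is an injective envelope of
the kernel of `Iʲ → Iʲ⁺¹` for every `j`, that is, if this kernel is essential in `Iʲ`
(for `j = 0` the kernel is the image of `M`, for `j > 0` it is the image of `Iʲ⁻¹`). -/
def IsMinimalCoresolution {Λ : Type u} [Ring Λ] {M : ModuleCat.{u} Λ}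
    (I : InjectiveResolution M) : Prop :=
  ∀ j : ℕ, IsEssential (LinearMap.ker (I.cocomplex.d j (j + 1)).hom)

/-- The dominant dimension of `Λ` as a left module over itself: the supremum of all `d` such that
the terms `I⁰, …, Iᵈ⁻¹` of a minimal injective coresolution of `Λ` are projective. -/
noncomputable def dominantDimension (Λ : Type u) [Ring Λ] : ℕ∞ :=
  sSup {x : ℕ∞ | ∃ d : ℕ, x = (d : ℕ∞) ∧
    ∃ I : InjectiveResolution (ModuleCat.of Λ Λ), IsMinimalCoresolution I ∧
      ∀ j : ℕ, j < d → Module.Projective Λ (I.cocomplex.X j)}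

/-- `id Λ ≤ n + 1 ≤ domdim Λ`, for `Λ` as a left module over itself. (That `Λ` is an Artin algebra
is recorded separately.) -/
def IsMinimalAuslanderGorenstein (Λ : Type u) [Ring Λ] (n : ℕ) : Prop :=
  injectiveDimension (ModuleCat.of Λ Λ) ≤ ((n + 1 : ℕ) : WithBot ℕ∞) ∧
    ((n + 1 : ℕ) : ℕ∞) ≤ dominantDimension Λ

/-- A complex of finitely generated projective modules is totally acyclic if it is exact and stays
exact after applying `Hom(-, Λ)`. -/
structure IsTotallyAcyclic {Λ : Type u} [Ring Λ] (P : CochainComplex (ModuleCat.{u} Λ) ℤ) :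
    Prop where
  finite : ∀ i : ℤ, Module.Finite Λ (P.X i)
  projective : ∀ i : ℤ, Module.Projective Λ (P.X i)
  exact : ∀ i : ℤ, Function.Exact (P.d i (i + 1)).hom (P.d (i + 1) (i + 2)).hom
  hom_exact : ∀ i : ℤ, Function.Exact
    (fun f : P.X (i + 2) →ₗ[Λ] Λ => f ∘ₗ (P.d (i + 1) (i + 2)).hom)
    (fun f : P.X (i + 1) →ₗ[Λ] Λ => f ∘ₗ (P.d i (i + 1)).hom)

/-- A module is (finitely generated) Gorenstein projective if it is isomorphic to the module of
`0`-cocycles of a totally acyclic complex. -/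
def IsGorensteinProjective {Λ : Type u} [Ring Λ] (M : ModuleCat.{u} Λ) : Prop :=
  ∃ P : CochainComplex (ModuleCat.{u} Λ) ℤ, IsTotallyAcyclic P ∧
    Nonempty (M ≃ₗ[Λ] LinearMap.ker (P.d 0 1).hom)

/-- There is an exact sequence `0 → G_m → ⋯ → G_1 → G_0 → M → 0` with all `G_i` Gorenstein
projective. -/
def HasGorensteinProjectiveResolution {Λ : Type u} [Ring Λ] (M : ModuleCat.{u} Λ) (m : ℕ) :
    Prop :=
  ∃ (G : ChainComplex (ModuleCat.{u} Λ) ℕ) (ε : G.X 0 ⟶ M),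
    (∀ i : ℕ, i ≤ m → IsGorensteinProjective (G.X i)) ∧
    (∀ i : ℕ, m < i → Subsingleton (G.X i)) ∧
    Function.Surjective ε.hom ∧
    Function.Exact (G.d 1 0).hom ε.hom ∧
    ∀ i : ℕ, Function.Exact (G.d (i + 2) (i + 1)).hom (G.d (i + 1) i).hom

/-- The Gorenstein projective dimension: the least length of a resolution by Gorenstein projective
modules, and `⊤` if there is none. -/
noncomputable def gpd {Λ : Type u} [Ring Λ] (M : ModuleCat.{u} Λ) : ℕ∞ :=
  sInf {x : ℕ∞ | ∃ m : ℕ, x = (m : ℕ∞) ∧ HasGorensteinProjectiveResolution M m}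

/-- The socle of a module: the sum of its simple submodules. -/
def socle {Λ : Type u} [Ring Λ] (M : ModuleCat.{u} Λ) : Submodule Λ M :=
  sSup {S : Submodule Λ M | IsSimpleModule Λ S}

/-- The socle as a module in its own right. -/
def soc {Λ : Type u} [Ring Λ] (M : ModuleCat.{u} Λ) : ModuleCat.{u} Λ :=
  ModuleCat.of Λ (socle M)

/-- `M` is cogenerated by (i.e. embeds into) a finite direct sum of copies of `Λ`. -/
def IsCogeneratedByFree {Λ : Type u} [Ring Λ] (M : ModuleCat.{u} Λ) : Prop :=
  ∃ (m : ℕ) (f : M →ₗ[Λ] (Fin m → Λ)), Function.Injective f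

/-- The finitely generated modules of Gorenstein projective dimension at most `n`. -/
def GPle (Λ : Type u) [Ring Λ] (n : ℕ) : Set (ModuleCat.{u} Λ) :=
  {N | Module.Finite Λ N ∧ gpd N ≤ (n : ℕ∞)}

/-- The finitely generated modules cogenerated by a finite direct sum of copies of `Λ`. -/
def subΛ (Λ : Type u) [Ring Λ] : Set (ModuleCat.{u} Λ) :=
  {N | Module.Finite Λ N ∧ IsCogeneratedByFree N}

end AuslanderGorenstein

/-!
The equivalence rests on modules of large dominant dimension, encoded by `DomDimGE k X`: there is an
exact sequence `0 → X → Q⁰ → ⋯ → Qᵏ⁻¹` with `Qʲ` finitely generated, projective and injective.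

*Small Gorenstein projective dimension implies cogeneration.* The algebra, hence every finitely
generated projective module, hence every Gorenstein projective module, has dominant dimension at
least `n + 1`. A cokernel loses at most one (`DomDimGE.cokernel`), so a module `N` with `Gpd N ≤ n`
has dominant dimension at least `1` and embeds in a free module.

*The socle.* Since `Λ` embeds in a projective-injective module, embedding a module in a free module
can be tested on its simple submodules (`isCogeneratedByFree_of_simple`).

*Cogeneration implies small Gorenstein projective dimension.* If `N ⊆ Λᵐ`, then `id Λ ≤ n + 1` gives
`Extⁱ(X, Λ) = 0` for `i > 0`, where `X` is the `n`-th syzygy of `N`. Such an orthogonal module is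
Gorenstein projective as soon as all orthogonal modules are torsionless: a left approximation of `X`
by a free module is then injective with orthogonal cokernel, and the construction can be iterated.
The torsion part `W` of an orthogonal module satisfies `Hom(W, Λ) = 0 = Extⁿ⁺¹(W, Λ)`, and it has to
be shown that `W = 0` (`subsingleton_of_extVanishes`).

This last point is a counting argument. For each indecomposable projective module `P` there is a
coresolution `0 → P → Q⁰ → ⋯ → Qⁿ → C → 0` with `C` injective. If `P` is injective, match its top
with a simple submodule of `P`; otherwise match it with a simple submodule `U` of `C` with
`Hom(U, Λ) = 0`, which exists because otherwise `C` would be projective and the sequence would split.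
This matching of the finitely many simple modules is injective (`SimpleMatch.nonempty_equiv`): a
direct summand `E` of `C` containing `U` has projective dimension `n + 1`, because otherwise it would
be torsionless, and `Extⁿ⁺¹(E, S) ≠ 0` for a simple module `S` forces `S` to be the top of `P`. Hence
the matching is onto, and every simple module embeds in some `P` or in some `C`. As
`Hom(W, Λ) = 0 = Extⁿ⁺¹(W, Λ)` implies `Hom(W, P) = 0 = Hom(W, C)`, the module `W` has no simple
quotient.
-/

namespace AuslanderGorenstein

/-! ### Short exact sequences and vanishing of `Ext` -/

section ExtVanishing

variable {Λ : Type u} [Ring Λ]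

/-- `0 → A → B → C → 0` is a short exact sequence of modules. -/
structure IsShortExact {A B C : Type u} [AddCommGroup A] [Module Λ A] [AddCommGroup B] [Module Λ B]
    [AddCommGroup C] [Module Λ C] (f : A →ₗ[Λ] B) (g : B →ₗ[Λ] C) : Prop where
  injective : Function.Injective f
  exact : Function.Exact f g
  surjective : Function.Surjective g

/-- `Extⁱ(X, Y) = 0`. -/
def ExtVanishes (i : ℕ) (X Y : ModuleCat.{u} Λ) : Prop :=
  Subsingleton (Abelian.Ext.{u} X Y i)

section Constructions

variable {A B C : Type u} [AddCommGroup A] [Module Λ A] [AddCommGroup B] [Module Λ B]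
  [AddCommGroup C] [Module Λ C]

lemma isShortExact_mkQ (K : Submodule Λ B) : IsShortExact K.subtype K.mkQ :=
  ⟨K.injective_subtype, LinearMap.exact_subtype_mkQ K, K.mkQ_surjective⟩

lemma isShortExact_of_injective {f : A →ₗ[Λ] B} (hf : Function.Injective f) :
    IsShortExact f (LinearMap.range f).mkQ :=
  ⟨hf, LinearMap.exact_iff.2 (by simp), Submodule.mkQ_surjective _⟩

lemma isShortExact_of_surjective {g : B →ₗ[Λ] C} (hg : Function.Surjective g) :
    IsShortExact (LinearMap.ker g).subtype g :=
  ⟨Submodule.injective_subtype _, LinearMap.exact_iff.2 (by simp), hg⟩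

lemma isShortExact_ker_of_exact {f : A →ₗ[Λ] B} {g : B →ₗ[Λ] C} (h : Function.Exact f g) :
    IsShortExact (LinearMap.ker f).subtype
      (f.codRestrict (LinearMap.ker g) fun x =>
        LinearMap.mem_ker.2 (h.apply_apply_eq_zero x)) := by
  refine ⟨Submodule.injective_subtype _, LinearMap.exact_iff.2 ?_, fun y => ?_⟩
  · rw [LinearMap.ker_codRestrict, Submodule.range_subtype]
  · obtain ⟨x, hx⟩ := (h y).1 y.2
    exact ⟨x, Subtype.ext hx⟩

end Constructions

variable {A B C : ModuleCat.{u} Λ} {f : A →ₗ[Λ] B} {g : B →ₗ[Λ] C}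

lemma IsShortExact.comp_eq_zero (h : IsShortExact f g) : g ∘ₗ f = 0 :=
  h.exact.linearMap_comp_eq_zero

lemma IsShortExact.exists_shortExact (h : IsShortExact f g) :
    ∃ w, (ShortComplex.mk (ModuleCat.ofHom f) (ModuleCat.ofHom g) w).ShortExact := by
  refine ⟨by rw [← ModuleCat.ofHom_comp, h.comp_eq_zero]; rfl, ?_⟩
  have : Mono (ModuleCat.ofHom f) := (ModuleCat.mono_iff_injective _).2 h.injective
  have : Epi (ModuleCat.ofHom g) := (ModuleCat.epi_iff_surjective _).2 h.surjective
  exact ⟨(ShortComplex.ShortExact.moduleCat_exact_iff_function_exact _).2 h.exact⟩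

/-- A linear equivalence on the left of a short exact sequence may be used to replace its first
term. -/
lemma IsShortExact.comp_equiv (h : IsShortExact f g) {A' : ModuleCat.{u} Λ} (e : A' ≃ₗ[Λ] A) :
    IsShortExact (f ∘ₗ e.toLinearMap) g :=
  ⟨h.injective.comp e.injective, fun y => by
    rw [h.exact y]
    exact ⟨fun ⟨x, hx⟩ => ⟨e.symm x, by simpa using hx⟩, fun ⟨x, hx⟩ => ⟨e x, by simpa using hx⟩⟩,
    h.surjective⟩

lemma ExtVanishes.eq_zero {i : ℕ} {X Y : ModuleCat.{u} Λ} (h : ExtVanishes i X Y)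
    (e : Abelian.Ext.{u} X Y i) : e = 0 :=
  h.elim _ _

lemma extVanishes_of_forall {i : ℕ} {X Y : ModuleCat.{u} Λ}
    (h : ∀ e : Abelian.Ext.{u} X Y i, e = 0) : ExtVanishes i X Y :=
  ⟨fun a b => (h a).trans (h b).symm⟩

lemma extVanishes_zero_iff {X Y : ModuleCat.{u} Λ} :
    ExtVanishes 0 X Y ↔ ∀ f : X →ₗ[Λ] Y, f = 0 := by
  constructor
  · intro h f
    have := (Abelian.Ext.mk₀_eq_zero_iff (ModuleCat.ofHom f)).1 (h.eq_zero _)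
    exact congrArg ModuleCat.Hom.hom this
  · intro h
    refine extVanishes_of_forall fun e => ?_
    obtain ⟨f, rfl⟩ := (Abelian.Ext.mk₀_bijective X Y).2 e
    rw [Abelian.Ext.mk₀_eq_zero_iff]
    exact ModuleCat.hom_ext (h f.hom)

lemma ExtVanishes.of_projective {P : ModuleCat.{u} Λ} [Module.Projective Λ P] (i : ℕ)
    (Y : ModuleCat.{u} Λ) : ExtVanishes (i + 1) P Y :=
  extVanishes_of_forall fun e => e.eq_zero_of_projective

lemma ExtVanishes.of_injective {I : ModuleCat.{u} Λ} [hI : Module.Injective Λ I] (i : ℕ)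
    (X : ModuleCat.{u} Λ) : ExtVanishes (i + 1) X I := by
  have : Injective I := Module.injective_object_of_injective_module Λ I
  exact extVanishes_of_forall fun e => e.eq_zero_of_injective

/-- Vanishing in a retract of the second variable. -/
lemma ExtVanishes.retract_right {i : ℕ} {X Y Z : ModuleCat.{u} Λ} (h : ExtVanishes i X Y)
    {s : Z →ₗ[Λ] Y} {r : Y →ₗ[Λ] Z} (hrs : r ∘ₗ s = LinearMap.id) : ExtVanishes i X Z := by
  refine extVanishes_of_forall fun e => ?_
  have h1 : ModuleCat.ofHom s ≫ ModuleCat.ofHom r = 𝟙 Z := by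
    rw [← ModuleCat.ofHom_comp, hrs]; rfl
  rw [← e.comp_mk₀_id, ← h1, ← Abelian.Ext.mk₀_comp_mk₀,
    ← Abelian.Ext.comp_assoc_of_third_deg_zero _ _ _ (add_zero i),
    h.eq_zero (e.comp (Abelian.Ext.mk₀ (ModuleCat.ofHom s)) (add_zero i)), Abelian.Ext.zero_comp]

/-- Vanishing in a retract of the first variable. -/
lemma ExtVanishes.retract_left {i : ℕ} {X Y Z : ModuleCat.{u} Λ} (h : ExtVanishes i Y X)
    {s : Z →ₗ[Λ] Y} {r : Y →ₗ[Λ] Z} (hrs : r ∘ₗ s = LinearMap.id) : ExtVanishes i Z X := by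
  refine extVanishes_of_forall fun e => ?_
  have h1 : ModuleCat.ofHom s ≫ ModuleCat.ofHom r = 𝟙 Z := by
    rw [← ModuleCat.ofHom_comp, hrs]; rfl
  rw [← e.mk₀_id_comp, ← h1, ← Abelian.Ext.mk₀_comp_mk₀_assoc,
    h.eq_zero ((Abelian.Ext.mk₀ (ModuleCat.ofHom r)).comp e (zero_add i)), Abelian.Ext.comp_zero]

namespace IsShortExact

variable (h : IsShortExact f g)
include h

lemma right_middle {i : ℕ} {X : ModuleCat.{u} Λ} (h₁ : ExtVanishes i X A)
    (h₃ : ExtVanishes i X C) : ExtVanishes i X B := by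
  obtain ⟨w, hS⟩ := h.exists_shortExact
  refine extVanishes_of_forall fun e => ?_
  obtain ⟨a, rfl⟩ := Abelian.Ext.covariant_sequence_exact₂ X hS e (h₃.eq_zero _)
  rw [h₁.eq_zero a, Abelian.Ext.zero_comp]

lemma right_last {i : ℕ} {X : ModuleCat.{u} Λ} (h₁ : ExtVanishes (i + 1) X A)
    (h₂ : ExtVanishes i X B) : ExtVanishes i X C := by
  obtain ⟨w, hS⟩ := h.exists_shortExact
  refine extVanishes_of_forall fun e => ?_
  obtain ⟨a, rfl⟩ := Abelian.Ext.covariant_sequence_exact₃ X hS e rfl (h₁.eq_zero _)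
  rw [h₂.eq_zero a, Abelian.Ext.zero_comp]

lemma left_first {i : ℕ} {Y : ModuleCat.{u} Λ} (h₂ : ExtVanishes i B Y)
    (h₃ : ExtVanishes (i + 1) C Y) : ExtVanishes i A Y := by
  obtain ⟨w, hS⟩ := h.exists_shortExact
  refine extVanishes_of_forall fun e => ?_
  obtain ⟨a, rfl⟩ := Abelian.Ext.contravariant_sequence_exact₁ hS Y e (add_comm 1 i) (h₃.eq_zero _)
  rw [h₂.eq_zero a, Abelian.Ext.comp_zero]

lemma left_last {i : ℕ} {Y : ModuleCat.{u} Λ} (h₁ : ExtVanishes i A Y)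
    (h₂ : ExtVanishes (i + 1) B Y) : ExtVanishes (i + 1) C Y := by
  obtain ⟨w, hS⟩ := h.exists_shortExact
  refine extVanishes_of_forall fun e => ?_
  obtain ⟨a, rfl⟩ := Abelian.Ext.contravariant_sequence_exact₃ hS Y e (h₂.eq_zero _) (add_comm 1 i)
  rw [h₁.eq_zero a, Abelian.Ext.comp_zero]

/-- If `Ext¹(C, Y) = 0`, then every map `A → Y` extends to `B`. -/
lemma exists_extension {Y : ModuleCat.{u} Λ} (hY : ExtVanishes 1 C Y) (φ : A →ₗ[Λ] Y) :
    ∃ ψ : B →ₗ[Λ] Y, ψ ∘ₗ f = φ := by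
  obtain ⟨w, hS⟩ := h.exists_shortExact
  obtain ⟨b, hb⟩ := Abelian.Ext.contravariant_sequence_exact₁ hS Y
    (Abelian.Ext.mk₀ (ModuleCat.ofHom φ)) rfl (hY.eq_zero _)
  obtain ⟨ψ, rfl⟩ := (Abelian.Ext.mk₀_bijective _ _).2 b
  rw [Abelian.Ext.mk₀_comp_mk₀] at hb
  exact ⟨ψ.hom, congrArg ModuleCat.Hom.hom ((Abelian.Ext.mk₀_bijective _ _).1 hb)⟩

/-- If every map `A → Y` extends to `B` and `Ext¹(B, Y) = 0`, then `Ext¹(C, Y) = 0`. -/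
lemma extVanishes_one_of_extension {Y : ModuleCat.{u} Λ} (hB : ExtVanishes 1 B Y)
    (hext : ∀ φ : A →ₗ[Λ] Y, ∃ ψ : B →ₗ[Λ] Y, ψ ∘ₗ f = φ) : ExtVanishes 1 C Y := by
  obtain ⟨w, hS⟩ := h.exists_shortExact
  refine extVanishes_of_forall fun e => ?_
  obtain ⟨a, rfl⟩ := Abelian.Ext.contravariant_sequence_exact₃ hS Y e (hB.eq_zero _) (add_zero 1)
  obtain ⟨φ, rfl⟩ := (Abelian.Ext.mk₀_bijective _ _).2 a
  obtain ⟨ψ, hψ⟩ := hext φ.hom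
  have : φ = ModuleCat.ofHom f ≫ ModuleCat.ofHom ψ := ModuleCat.hom_ext hψ.symm
  rw [this, ← Abelian.Ext.mk₀_comp_mk₀, hS.extClass_comp_assoc]

end IsShortExact

/-- If `Ext¹(C, A) = 0`, then the epimorphism `B → C` splits. -/
lemma IsShortExact.exists_section (h : IsShortExact f g) (hA : ExtVanishes 1 C A) :
    ∃ s : C →ₗ[Λ] B, g ∘ₗ s = LinearMap.id := by
  obtain ⟨r, hr⟩ := h.exists_extension hA LinearMap.id
  have hsplit : (∃ l, l ∘ₗ f = LinearMap.id) → ∃ l, g ∘ₗ l = LinearMap.id :=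
    ((h.exact.split_tfae h.injective h.surjective).out 1 0).1
  exact hsplit ⟨r, hr⟩

end ExtVanishing

/-! ### Modules of large dominant dimension -/

section DominantDimension

variable {Λ : Type u} [Ring Λ]

/-- A finitely generated module that is both projective and injective. -/
structure IsProjInj (Q : ModuleCat.{u} Λ) : Prop where
  finite : Module.Finite Λ Q
  projective : Module.Projective Λ Q
  injective : Module.Injective Λ Q

/-- `C` is a `k`-th cosyzygy of `X` through projective-injective modules: there is an exact sequence
`0 → X → Q⁰ → ⋯ → Qᵏ⁻¹ → C → 0` with all `Qʲ` finitely generated, projective and injective. -/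
def IsCosyzygy : ℕ → ModuleCat.{u} Λ → ModuleCat.{u} Λ → Prop
  | 0, X, C => Nonempty (X ≃ₗ[Λ] C)
  | k + 1, X, C => ∃ (Q Y : ModuleCat.{u} Λ) (f : X →ₗ[Λ] Q) (g : Q →ₗ[Λ] Y),
      IsProjInj Q ∧ IsShortExact f g ∧ IsCosyzygy k Y C

/-- The dominant dimension of `X` is at least `k`, with finitely generated terms in the
coresolution. -/
def DomDimGE (k : ℕ) (X : ModuleCat.{u} Λ) : Prop :=
  ∃ C : ModuleCat.{u} Λ, IsCosyzygy k X C

lemma domDimGE_zero (X : ModuleCat.{u} Λ) : DomDimGE 0 X :=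
  ⟨X, ⟨LinearEquiv.refl Λ X⟩⟩

lemma DomDimGE.succ {k : ℕ} {X Q Y : ModuleCat.{u} Λ} {f : X →ₗ[Λ] Q} {g : Q →ₗ[Λ] Y}
    (hQ : IsProjInj Q) (h : IsShortExact f g) (hY : DomDimGE k Y) : DomDimGE (k + 1) X :=
  let ⟨C, hC⟩ := hY
  ⟨C, Q, Y, f, g, hQ, h, hC⟩

lemma DomDimGE.exists_succ {k : ℕ} {X : ModuleCat.{u} Λ} (hX : DomDimGE (k + 1) X) :
    ∃ (Q Y : ModuleCat.{u} Λ) (f : X →ₗ[Λ] Q) (g : Q →ₗ[Λ] Y),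
      IsProjInj Q ∧ IsShortExact f g ∧ DomDimGE k Y :=
  let ⟨C, Q, Y, f, g, hQ, h, hC⟩ := hX
  ⟨Q, Y, f, g, hQ, h, C, hC⟩

lemma DomDimGE.of_equiv {k : ℕ} {X X' : ModuleCat.{u} Λ} (e : X' ≃ₗ[Λ] X) (hX : DomDimGE k X) :
    DomDimGE k X' := by
  cases k with
  | zero => exact domDimGE_zero X'
  | succ k =>
    obtain ⟨Q, Y, f, g, hQ, h, hY⟩ := hX.exists_succ
    exact .succ hQ (h.comp_equiv e) hY

/-- A short exact sequence is isomorphic to the one given by the quotient by the range. -/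
noncomputable def IsShortExact.quotEquiv {A B C : ModuleCat.{u} Λ} {f : A →ₗ[Λ] B} {g : B →ₗ[Λ] C}
    (h : IsShortExact f g) : (B ⧸ LinearMap.range f) ≃ₗ[Λ] C :=
  h.exact.linearEquivOfSurjective h.surjective

lemma DomDimGE.exists_succ_quot {k : ℕ} {X : ModuleCat.{u} Λ} (hX : DomDimGE (k + 1) X) :
    ∃ (Q : ModuleCat.{u} Λ) (f : X →ₗ[Λ] Q),
      IsProjInj Q ∧ Function.Injective f ∧
        DomDimGE k (ModuleCat.of Λ (Q ⧸ LinearMap.range f)) := by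
  obtain ⟨Q, Y, f, g, hQ, h, hY⟩ := hX.exists_succ
  exact ⟨Q, f, hQ, h.injective, hY.of_equiv (X' := ModuleCat.of Λ (Q ⧸ LinearMap.range f))
    h.quotEquiv⟩

lemma DomDimGE.succ_quot {k : ℕ} {X Q : ModuleCat.{u} Λ} {f : X →ₗ[Λ] Q}
    (hQ : IsProjInj Q) (hf : Function.Injective f)
    (hY : DomDimGE k (ModuleCat.of Λ (Q ⧸ LinearMap.range f))) : DomDimGE (k + 1) X :=
  .succ (Y := ModuleCat.of Λ (Q ⧸ LinearMap.range f)) hQ (isShortExact_of_injective hf) hY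

lemma isProjInj_prod {Q Q' : ModuleCat.{u} Λ} (hQ : IsProjInj Q) (hQ' : IsProjInj Q') :
    IsProjInj (ModuleCat.of Λ (Q × Q')) := by
  have := hQ.finite; have := hQ'.finite
  have := hQ.projective; have := hQ'.projective
  refine ⟨inferInstanceAs (Module.Finite Λ (Q × Q')),
    inferInstanceAs (Module.Projective Λ (Q × Q')), ⟨fun X Y _ _ _ _ f hf g => ?_⟩⟩
  obtain ⟨h1, hh1⟩ := hQ.injective.out f hf (LinearMap.fst Λ Q Q' ∘ₗ g)
  obtain ⟨h2, hh2⟩ := hQ'.injective.out f hf (LinearMap.snd Λ Q Q' ∘ₗ g)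
  exact ⟨h1.prod h2, fun x => Prod.ext (hh1 x) (hh2 x)⟩

lemma exists_extension_of_injective {A B Q : ModuleCat.{u} Λ} (hQ : Module.Injective Λ Q)
    {f : A →ₗ[Λ] B} (hf : Function.Injective f) (φ : A →ₗ[Λ] Q) :
    ∃ ψ : B →ₗ[Λ] Q, ∀ a, ψ (f a) = φ a :=
  hQ.out f hf φ

lemma isShortExact_prod (X Y : ModuleCat.{u} Λ) :
    IsShortExact (A := X) (B := ModuleCat.of Λ (X × Y)) (C := Y)
      (LinearMap.inl Λ X Y) (LinearMap.snd Λ X Y) :=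
  ⟨LinearMap.inl_injective, LinearMap.exact_iff.2 (LinearMap.range_inl Λ X Y).symm,
    LinearMap.snd_surjective⟩

lemma isShortExact_prod' (X Y : ModuleCat.{u} Λ) :
    IsShortExact (A := Y) (B := ModuleCat.of Λ (X × Y)) (C := X)
      (LinearMap.inr Λ X Y) (LinearMap.fst Λ X Y) :=
  ⟨LinearMap.inr_injective, LinearMap.exact_iff.2 (LinearMap.range_inr Λ X Y).symm,
    LinearMap.fst_surjective⟩

variable {A B C : ModuleCat.{u} Λ} {f : A →ₗ[Λ] B} {g : B →ₗ[Λ] C}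

/-- The modules of dominant dimension at least `k` are closed under extensions (horseshoe
lemma). -/
lemma DomDimGE.extension {k : ℕ} (h : IsShortExact f g) (hA : DomDimGE k A) (hC : DomDimGE k C) :
    DomDimGE k B := by
  induction k generalizing A B C with
  | zero => exact domDimGE_zero B
  | succ k ih =>
    obtain ⟨Q, α, hQ, hα, hA'⟩ := hA.exists_succ_quot
    obtain ⟨Q', γ, hQ', hγ, hC'⟩ := hC.exists_succ_quot
    obtain ⟨α', hα'⟩ := exists_extension_of_injective hQ.injective h.injective α
    let β : B →ₗ[Λ] ModuleCat.of Λ (Q × Q') := α'.prod (γ ∘ₗ g)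
    have hgf : ∀ a, g (f a) = 0 := fun a => (h.exact (f a)).2 ⟨a, rfl⟩
    have hβ : Function.Injective β := by
      rw [injective_iff_map_eq_zero]
      intro b hb
      have h1 : α' b = 0 := congrArg Prod.fst hb
      have h2 : γ (g b) = 0 := congrArg Prod.snd hb
      obtain ⟨a, rfl⟩ := (h.exact b).1 ((map_eq_zero_iff γ hγ).1 h2)
      rw [hα', map_eq_zero_iff α hα] at h1
      rw [h1, map_zero]
    refine .succ_quot (isProjInj_prod hQ hQ') hβ ?_
    have h1 : LinearMap.range α ≤ (LinearMap.range β).comap (LinearMap.inl Λ Q Q') := by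
      rintro _ ⟨a, rfl⟩
      exact ⟨f a, Prod.ext (hα' a) (by simp [β, hgf])⟩
    have h2 : LinearMap.range β ≤ (LinearMap.range γ).comap (LinearMap.snd Λ Q Q') := by
      rintro _ ⟨b, rfl⟩
      exact ⟨g b, rfl⟩
    refine ih (A := ModuleCat.of Λ (Q ⧸ LinearMap.range α))
      (C := ModuleCat.of Λ (Q' ⧸ LinearMap.range γ))
      (f := (LinearMap.range α).mapQ (LinearMap.range β) _ h1)
      (g := (LinearMap.range β).mapQ (LinearMap.range γ) _ h2) ⟨?_, ?_, ?_⟩ hA' hC'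
    · rw [injective_iff_map_eq_zero]
      intro y hy
      obtain ⟨y, rfl⟩ := Submodule.Quotient.mk_surjective _ y
      obtain ⟨b, hb⟩ := (Submodule.Quotient.mk_eq_zero _).1 hy
      have hb1 : α' b = y := congrArg Prod.fst hb
      have hb2 : γ (g b) = 0 := congrArg Prod.snd hb
      obtain ⟨a, rfl⟩ := (h.exact b).1 ((map_eq_zero_iff γ hγ).1 hb2)
      exact (Submodule.Quotient.mk_eq_zero _).2 ⟨a, by rw [← hb1, hα']⟩
    · intro y
      constructor
      · intro hy
        obtain ⟨⟨q, q'⟩, rfl⟩ := Submodule.Quotient.mk_surjective _ y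
        obtain ⟨c, hc⟩ := (Submodule.Quotient.mk_eq_zero _).1 hy
        obtain ⟨b, rfl⟩ := h.surjective c
        refine ⟨Submodule.Quotient.mk (q - α' b), ?_⟩
        refine (Submodule.Quotient.eq _).2 ⟨-b, Prod.ext ?_ ?_⟩
        · simp [β]
        · have : γ (g b) = q' := hc
          simp [β, this]
      · rintro ⟨y, rfl⟩
        obtain ⟨y, rfl⟩ := Submodule.Quotient.mk_surjective _ y
        exact (Submodule.Quotient.mk_eq_zero _).2 ⟨0, by simp⟩
    · intro y
      obtain ⟨y, rfl⟩ := Submodule.Quotient.mk_surjective _ y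
      exact ⟨Submodule.Quotient.mk (0, y), rfl⟩

/-- The kernel of an epimorphism from a module of dominant dimension at least `k + 1` to one of
dominant dimension at least `k` has dominant dimension at least `k + 1`. -/
lemma DomDimGE.kernel {k : ℕ} (h : IsShortExact f g) (hB : DomDimGE (k + 1) B)
    (hC : DomDimGE k C) : DomDimGE (k + 1) A := by
  obtain ⟨Q, j, hQ, hj, hY⟩ := hB.exists_succ_quot
  have hC' : DomDimGE k (ModuleCat.of Λ (B ⧸ LinearMap.range f)) := hC.of_equiv h.quotEquiv
  refine .succ_quot (f := j ∘ₗ f) hQ (hj.comp h.injective) ?_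
  have h1 : LinearMap.range f ≤ (LinearMap.range (j ∘ₗ f)).comap j := by
    rintro _ ⟨a, rfl⟩
    exact ⟨a, rfl⟩
  have h2 : LinearMap.range (j ∘ₗ f) ≤ (LinearMap.range j).comap LinearMap.id := by
    rintro _ ⟨a, rfl⟩
    exact ⟨f a, rfl⟩
  refine DomDimGE.extension (A := ModuleCat.of Λ (B ⧸ LinearMap.range f))
      (C := ModuleCat.of Λ (Q ⧸ LinearMap.range j))
      (f := (LinearMap.range f).mapQ (LinearMap.range (j ∘ₗ f)) _ h1)
      (g := (LinearMap.range (j ∘ₗ f)).mapQ (LinearMap.range j) _ h2) ⟨?_, ?_, ?_⟩ hC' hY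
  · rw [injective_iff_map_eq_zero]
    intro y hy
    obtain ⟨y, rfl⟩ := Submodule.Quotient.mk_surjective _ y
    obtain ⟨a, ha⟩ := (Submodule.Quotient.mk_eq_zero _).1 hy
    exact (Submodule.Quotient.mk_eq_zero _).2 ⟨a, hj ha⟩
  · intro y
    constructor
    · intro hy
      obtain ⟨y, rfl⟩ := Submodule.Quotient.mk_surjective _ y
      obtain ⟨b, hb⟩ := (Submodule.Quotient.mk_eq_zero _).1 hy
      exact ⟨Submodule.Quotient.mk b, congrArg Submodule.Quotient.mk hb⟩
    · rintro ⟨y, rfl⟩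
      obtain ⟨y, rfl⟩ := Submodule.Quotient.mk_surjective _ y
      exact (Submodule.Quotient.mk_eq_zero _).2 ⟨y, rfl⟩
  · intro y
    obtain ⟨y, rfl⟩ := Submodule.Quotient.mk_surjective _ y
    exact ⟨Submodule.Quotient.mk y, rfl⟩

lemma DomDimGE.of_succ {k : ℕ} {X : ModuleCat.{u} Λ} (hX : DomDimGE (k + 1) X) :
    DomDimGE k X := by
  induction k generalizing X with
  | zero => exact domDimGE_zero X
  | succ k ih =>
    obtain ⟨Q, Y, f, g, hQ, h, hY⟩ := hX.exists_succ
    exact .succ hQ h (ih hY)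

lemma DomDimGE.mono {k l : ℕ} (hkl : k ≤ l) {X : ModuleCat.{u} Λ} (hX : DomDimGE l X) :
    DomDimGE k X := by
  induction l, hkl using Nat.le_induction with
  | base => exact hX
  | succ l _ ih => exact ih hX.of_succ

lemma DomDimGE.of_subsingleton (k : ℕ) (X : ModuleCat.{u} Λ) [Subsingleton X] : DomDimGE k X := by
  have : Module.Free Λ X := Module.Free.of_subsingleton Λ X
  induction k with
  | zero => exact domDimGE_zero X
  | succ k ih =>
    refine .succ (Q := X) (Y := X) (f := 0) (g := 0) ⟨inferInstance, .of_free,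
      ⟨fun _ _ _ _ _ _ _ _ _ => ⟨0, fun _ => Subsingleton.elim _ _⟩⟩⟩
      ⟨Function.injective_of_subsingleton _, fun y => ?_, fun y => ⟨y, Subsingleton.elim _ _⟩⟩ ih
    exact ⟨fun _ => ⟨y, Subsingleton.elim _ _⟩, fun _ => Subsingleton.elim _ _⟩

lemma IsProjInj.domDimGE {Q : ModuleCat.{u} Λ} (hQ : IsProjInj Q) (k : ℕ) : DomDimGE k Q := by
  cases k with
  | zero => exact domDimGE_zero Q
  | succ k =>
    refine .succ (Q := Q) (Y := ModuleCat.of Λ PUnit) (f := LinearMap.id) (g := 0) hQ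
      ⟨Function.injective_id, fun y => ⟨fun _ => ⟨y, rfl⟩, fun _ => rfl⟩, fun y => ⟨0, rfl⟩⟩
      (.of_subsingleton k (ModuleCat.of Λ PUnit))

/-- The cokernel of a monomorphism from a module of dominant dimension at least `k + 1` to one of
dominant dimension at least `k` has dominant dimension at least `k`. -/
lemma DomDimGE.cokernel {k : ℕ} (h : IsShortExact f g) (hA : DomDimGE (k + 1) A)
    (hB : DomDimGE k B) : DomDimGE k C := by
  cases k with
  | zero => exact domDimGE_zero C
  | succ k =>
    -- For `A ⊆ Q`, the pushout of `Q ← A → B` is `Q × C`, as `Q` is injective; it is thus an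
    -- extension of `Q / A` by `B`, and `C` is the kernel of its projection to `Q`.
    obtain ⟨Q, α, hQ, hα, hA'⟩ := hA.exists_succ_quot
    obtain ⟨α', hα'⟩ := exists_extension_of_injective hQ.injective h.injective α
    have hgf : ∀ a, g (f a) = 0 := fun a => (h.exact (f a)).2 ⟨a, rfl⟩
    let β : B →ₗ[Λ] ModuleCat.of Λ (Q × C) := α'.prod g
    have hβ : Function.Injective β := by
      rw [injective_iff_map_eq_zero]
      intro b hb
      have h1 : α' b = 0 := congrArg Prod.fst hb
      obtain ⟨a, rfl⟩ := (h.exact b).1 (congrArg Prod.snd hb)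
      rw [hα', map_eq_zero_iff α hα] at h1
      rw [h1, map_zero]
    have h1 : LinearMap.range α ≤ (LinearMap.range β).comap (LinearMap.inl Λ Q C) := by
      rintro _ ⟨a, rfl⟩
      exact ⟨f a, Prod.ext (hα' a) (by simp [β, hgf])⟩
    have hbij : Function.Bijective ((LinearMap.range α).mapQ (LinearMap.range β) _ h1) := by
      constructor
      · rw [injective_iff_map_eq_zero]
        intro y hy
        obtain ⟨y, rfl⟩ := Submodule.Quotient.mk_surjective _ y
        obtain ⟨b, hb⟩ := (Submodule.Quotient.mk_eq_zero _).1 hy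
        obtain ⟨a, rfl⟩ := (h.exact b).1 (congrArg Prod.snd hb)
        have hb1 : α' (f a) = y := congrArg Prod.fst hb
        exact (Submodule.Quotient.mk_eq_zero _).2 ⟨a, by rw [← hb1, hα']⟩
      · intro y
        obtain ⟨⟨q, c⟩, rfl⟩ := Submodule.Quotient.mk_surjective _ y
        obtain ⟨b, rfl⟩ := h.surjective c
        refine ⟨Submodule.Quotient.mk (q - α' b), ?_⟩
        exact (Submodule.Quotient.eq _).2 ⟨-b, Prod.ext (by simp [β]) (by simp [β])⟩
    have hY : DomDimGE (k + 1) (ModuleCat.of Λ ((Q × C) ⧸ LinearMap.range β)) :=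
      hA'.of_equiv (X := ModuleCat.of Λ (Q ⧸ LinearMap.range α)) (LinearEquiv.ofBijective _ hbij).symm
    have hQC : DomDimGE (k + 1) (ModuleCat.of Λ (Q × C)) :=
      DomDimGE.extension (isShortExact_of_injective hβ)
        (C := ModuleCat.of Λ ((Q × C) ⧸ LinearMap.range β)) hB hY
    exact DomDimGE.kernel (isShortExact_prod' Q C) hQC (hQ.domDimGE k)

end DominantDimension

/-! ### Cosyzygies -/

section Cosyzygy

variable {Λ : Type u} [Ring Λ] {k : ℕ} {X C : ModuleCat.{u} Λ}

lemma injective_of_extVanishes_one (h : ∀ W : ModuleCat.{u} Λ, ExtVanishes 1 W X) :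
    Module.Injective Λ X := by
  rw [Module.injective_iff_injective_object]
  exact injective_iff_subsingleton_ext_one.2 fun W => h W

lemma ExtVanishes.of_equiv_right {i : ℕ} {W Y Z : ModuleCat.{u} Λ} (e : Y ≃ₗ[Λ] Z)
    (h : ExtVanishes i W Y) : ExtVanishes i W Z :=
  h.retract_right (s := e.symm.toLinearMap) (r := e.toLinearMap) (by ext; simp)

lemma ExtVanishes.of_equiv_left {i : ℕ} {W Y Z : ModuleCat.{u} Λ} (e : Y ≃ₗ[Λ] Z)
    (h : ExtVanishes i Y W) : ExtVanishes i Z W :=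
  h.retract_left (s := e.symm.toLinearMap) (r := e.toLinearMap) (by ext; simp)

lemma IsCosyzygy.finite (h : IsCosyzygy k X C) (hX : Module.Finite Λ X) : Module.Finite Λ C := by
  induction k generalizing X with
  | zero => exact Module.Finite.equiv h.some
  | succ k ih =>
    obtain ⟨Q, Y, f, g, hQ, hfg, hY⟩ := h
    have := hQ.finite
    exact ih hY (Module.Finite.of_surjective g hfg.surjective)

lemma IsCosyzygy.injective (h : IsCosyzygy k X C)
    (hX : ∀ W : ModuleCat.{u} Λ, ExtVanishes (k + 1) W X) : Module.Injective Λ C := by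
  induction k generalizing X with
  | zero => exact injective_of_extVanishes_one fun W => (hX W).of_equiv_right h.some
  | succ k ih =>
    obtain ⟨Q, Y, f, g, hQ, hfg, hY⟩ := h
    have := hQ.injective
    exact ih hY fun W => hfg.right_last (hX W) (.of_injective k W)

/-- Dimension shift in the second variable, down to `Hom`, along a coresolution through modules
which receive no map from `W`. -/
lemma IsCosyzygy.extVanishes_zero (h : IsCosyzygy k X C) {W : ModuleCat.{u} Λ}
    (hW : ∀ Q : ModuleCat.{u} Λ, Module.Projective Λ Q → ExtVanishes 0 W Q)
    (hX : ExtVanishes k W X) : ExtVanishes 0 W C := by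
  induction k generalizing X with
  | zero => exact hX.of_equiv_right h.some
  | succ k ih =>
    obtain ⟨Q, Y, f, g, hQ, hfg, hY⟩ := h
    have := hQ.injective
    refine ih hY (hfg.right_last hX ?_)
    cases k with
    | zero => exact hW Q hQ.projective
    | succ k => exact .of_injective k W

/-- Dimension shift in the first variable. -/
lemma IsCosyzygy.extVanishes_left (h : IsCosyzygy k X C) {S : ModuleCat.{u} Λ} {j : ℕ}
    (hX : ExtVanishes j X S) : ExtVanishes (j + k) C S := by
  induction k generalizing X j with
  | zero => exact hX.of_equiv_left h.some
  | succ k ih =>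
    obtain ⟨Q, Y, f, g, hQ, hfg, hY⟩ := h
    have := hQ.projective
    have := ih hY (hfg.left_last hX (.of_projective j S))
    rwa [Nat.add_right_comm] at this

lemma injective_of_retract {Y Z : ModuleCat.{u} Λ} (hY : Module.Injective Λ Y)
    {s : Z →ₗ[Λ] Y} {r : Y →ₗ[Λ] Z} (hrs : r ∘ₗ s = LinearMap.id) : Module.Injective Λ Z := by
  refine ⟨fun A B _ _ _ _ f hf φ => ?_⟩
  obtain ⟨ψ, hψ⟩ := hY.out f hf (s ∘ₗ φ)
  exact ⟨r ∘ₗ ψ, fun a => by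
    simpa [hψ a] using LinearMap.congr_fun hrs (φ a)⟩

/-- If a coresolution through projective-injective modules ends in a projective-injective module,
then it splits, so that it starts with an injective module. -/
lemma IsCosyzygy.injective_of_projective (h : IsCosyzygy k X C) (hC : Module.Injective Λ C)
    (hC' : Module.Projective Λ C) : Module.Injective Λ X ∧ Module.Projective Λ X := by
  induction k generalizing X with
  | zero => exact ⟨injective_of_retract hC (s := h.some.toLinearMap) (r := h.some.symm.toLinearMap)
      (by ext; simp), Module.Projective.of_equiv h.some.symm⟩
  | succ k ih =>
    obtain ⟨Q, Y, f, g, hQ, hfg, hY⟩ := h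
    obtain ⟨-, hYp⟩ := ih hY
    have := hQ.projective
    obtain ⟨r, hr⟩ := hfg.exists_extension (.of_projective 0 X) LinearMap.id
    exact ⟨injective_of_retract hQ.injective hr, Module.Projective.of_split f r hr⟩

end Cosyzygy

/-! ### Modules cogenerated by the regular module -/

section Cogeneration

variable {Λ : Type u} [Ring Λ]

lemma isCogeneratedByFree_of_injective {X Y : ModuleCat.{u} Λ} (hY : IsCogeneratedByFree Y)
    (f : X →ₗ[Λ] Y) (hf : Function.Injective f) : IsCogeneratedByFree X := by
  obtain ⟨m, g, hg⟩ := hY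
  exact ⟨m, g ∘ₗ f, hg.comp hf⟩

lemma isCogeneratedByFree_of_projective (P : ModuleCat.{u} Λ) [Module.Finite Λ P]
    [Module.Projective Λ P] : IsCogeneratedByFree P := by
  obtain ⟨m, f, g, _, hg, _⟩ := Module.Finite.exists_comp_eq_id_of_projective Λ P
  exact ⟨m, g, hg⟩

lemma DomDimGE.isCogeneratedByFree {X : ModuleCat.{u} Λ} (hX : DomDimGE 1 X) :
    IsCogeneratedByFree X := by
  obtain ⟨Q, Y, f, g, hQ, hfg, hY⟩ := hX.exists_succ
  have := hQ.finite
  have := hQ.projective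
  exact isCogeneratedByFree_of_injective (isCogeneratedByFree_of_projective Q) f hfg.injective

/-- The regular module separates the elements of a projective module. -/
lemma exists_map_ne_zero_of_projective {P : Type u} [AddCommGroup P] [Module Λ P]
    [Module.Projective Λ P] {x : P} (hx : x ≠ 0) : ∃ φ : P →ₗ[Λ] Λ, φ x ≠ 0 := by
  obtain ⟨s, hs⟩ := (Module.projective_def' (R := Λ) (P := P)).1 inferInstance
  have hsx : s x ≠ 0 := fun h => hx (by simpa [h] using (LinearMap.congr_fun hs x).symm)
  obtain ⟨p, hp⟩ := Finsupp.ne_iff.1 hsx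
  exact ⟨Finsupp.lapply p ∘ₗ s, hp⟩

/-- An artinian module whose elements are separated by maps to `Λ` embeds in some `Λᵐ`. -/
lemma isCogeneratedByFree_of_separating {X : ModuleCat.{u} Λ} [IsArtinian Λ X]
    (h : ∀ x : X, x ≠ 0 → ∃ φ : X →ₗ[Λ] Λ, φ x ≠ 0) : IsCogeneratedByFree X := by
  obtain ⟨K, ⟨m, f, rfl⟩, hK⟩ := IsArtinian.set_has_minimal
    {K : Submodule Λ X | ∃ (m : ℕ) (f : X →ₗ[Λ] (Fin m → Λ)), K = LinearMap.ker f}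
    ⟨_, 0, 0, rfl⟩
  refine ⟨m, f, LinearMap.ker_eq_bot.1 ((Submodule.eq_bot_iff _).2 fun x hx => ?_)⟩
  by_contra hx0
  obtain ⟨φ, hφ⟩ := h x hx0
  let f' : X →ₗ[Λ] (Fin (m + 1) → Λ) := LinearMap.vecCons φ f
  have hf' : ∀ y, f' y = 0 ↔ φ y = 0 ∧ f y = 0 := fun y => by
    simp [f', LinearMap.vecCons_apply, Matrix.cons_eq_zero_iff]
  refine hK _ ⟨m + 1, f', rfl⟩ (lt_of_le_of_ne (fun y hy => ((hf' y).1 hy).2) fun heq => ?_)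
  exact hφ ((hf' x).1 (heq.symm ▸ hx : x ∈ LinearMap.ker f')).1

/-- Cogeneration by `Λ` can be tested on simple submodules, as `Λ` embeds in a
projective-injective module. -/
lemma isCogeneratedByFree_of_simple (hΛ : DomDimGE 1 (ModuleCat.of Λ Λ)) {X : ModuleCat.{u} Λ}
    [IsArtinian Λ X]
    (h : ∀ U : Submodule Λ X, IsSimpleModule Λ U → ∃ φ : U →ₗ[Λ] Λ, φ ≠ 0) :
    IsCogeneratedByFree X := by
  obtain ⟨Q, Y, j, _, hQ, hj, _⟩ := hΛ.exists_succ
  have := hQ.projective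
  refine isCogeneratedByFree_of_separating fun x hx => ?_
  obtain hbot | ⟨U, hU, hUx⟩ := IsAtomic.eq_bot_or_exists_atom_le (Submodule.span Λ {x})
  · exact absurd (Submodule.span_singleton_eq_bot.1 hbot) hx
  have hUs : IsSimpleModule Λ U := isSimpleModule_iff_isAtom.2 hU
  obtain ⟨φ, hφ⟩ := h U hUs
  obtain ⟨u, hu⟩ : ∃ u, φ u ≠ 0 := by
    by_contra! hcon
    exact hφ (LinearMap.ext hcon)
  obtain ⟨ψ, hψ⟩ := exists_extension_of_injective (A := ModuleCat.of Λ U) (B := X) hQ.injective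
    (f := U.subtype) U.injective_subtype (j ∘ₗ φ)
  have hux : ψ (u : X) ≠ 0 := by
    have h1 : ψ (u : X) = j (φ u) := hψ u
    rw [h1]
    exact (map_ne_zero_iff j hj.injective).2 hu
  obtain ⟨χ, hχ⟩ := exists_map_ne_zero_of_projective (Λ := Λ) hux
  obtain ⟨a, ha⟩ := Submodule.mem_span_singleton.1 (hUx u.2)
  refine ⟨χ ∘ₗ ψ, fun h0 => hχ ?_⟩
  have h0' : χ (ψ x) = 0 := h0
  rw [← ha, map_smul, map_smul, h0', smul_zero]

lemma isCogeneratedByFree_iff_separating {X : ModuleCat.{u} Λ} [IsArtinian Λ X] :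
    IsCogeneratedByFree X ↔ ∀ x : X, x ≠ 0 → ∃ φ : X →ₗ[Λ] Λ, φ x ≠ 0 := by
  refine ⟨?_, isCogeneratedByFree_of_separating⟩
  rintro ⟨m, f, hf⟩ x hx
  obtain ⟨i, hi⟩ := Function.ne_iff.1 ((map_ne_zero_iff f hf).2 hx)
  exact ⟨LinearMap.proj i ∘ₗ f, hi⟩

end Cogeneration

/-! ### Dominant dimension of the algebra and of Gorenstein projective modules -/

section Algebra

variable {Λ : Type u} [Ring Λ]

/-- An essential extension of a finitely generated module inside a projective module over a left
noetherian ring is finitely generated: a map to a finite free module that is injective on the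
small module is injective. -/
lemma finite_of_isEssential [IsNoetherianRing Λ] {Q : Type u} [AddCommGroup Q] [Module Λ Q]
    [Module.Projective Λ Q] {K : Submodule Λ Q} (hK : K.FG) (hess : IsEssential K) :
    Module.Finite Λ Q := by
  classical
  obtain ⟨s, hs⟩ := (Module.projective_def' (R := Λ) (P := Q)).1 inferInstance
  have hsinj : Function.Injective s := by
    intro x y hxy
    simpa [hxy] using (LinearMap.congr_fun hs x).symm.trans
      ((congrArg (Finsupp.linearCombination Λ id) hxy).trans (LinearMap.congr_fun hs y))
  obtain ⟨t, rfl⟩ := hK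
  -- The coordinates of `Q → Λ^(Q)` in which some element of the finite set `t` is nonzero.
  let c : Finset Q := t.biUnion fun x => (s x).support
  let f : Q →ₗ[Λ] (c → Λ) := LinearMap.pi fun i => Finsupp.lapply (i : Q) ∘ₗ s
  have hf : LinearMap.ker f = ⊥ := by
    refine hess _ ((Submodule.eq_bot_iff _).2 ?_)
    rintro x ⟨hx, hx0⟩
    have hsupp : ∀ y ∈ Submodule.span Λ (t : Set Q), s y ∈ Finsupp.supported Λ Λ (c : Set Q) := by
      intro y hy
      induction hy using Submodule.span_induction with
      | mem y hy => exact fun i hi => Finset.mem_biUnion.2 ⟨y, hy, hi⟩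
      | zero => simp
      | add y z _ _ hy hz => rw [map_add]; exact add_mem hy hz
      | smul a y _ hy => rw [map_smul]; exact Submodule.smul_mem _ a hy
    refine (map_eq_zero_iff s hsinj).1 (Finsupp.ext fun i => ?_)
    by_cases hi : i ∈ c
    · exact congrFun hx0 ⟨i, hi⟩
    · by_contra h0
      exact hi (hsupp x hx (Finsupp.mem_support_iff.2 h0))
  exact Module.Finite.of_injective f (LinearMap.ker_eq_bot.1 hf)

lemma exists_resolution_of_le_dominantDimension {d : ℕ}
    (h : ((d + 1 : ℕ) : ℕ∞) ≤ dominantDimension Λ) :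
    ∃ I : InjectiveResolution (ModuleCat.of Λ Λ), IsMinimalCoresolution I ∧
      ∀ j : ℕ, j < d + 1 → Module.Projective Λ (I.cocomplex.X j) := by
  by_contra! hcon
  have hle : dominantDimension Λ ≤ (d : ℕ∞) := by
    refine sSup_le ?_
    rintro _ ⟨e, rfl, I, hI, hp⟩
    by_contra hlt
    have hde : d < e := by exact_mod_cast not_le.1 hlt
    obtain ⟨j, hj, hjp⟩ := hcon I hI
    exact hjp (hp j (by omega))
  have := h.trans hle
  norm_cast at this
  omega

lemma nonempty_equiv_ker_zero {Z : ModuleCat.{u} Λ} (I : InjectiveResolution Z) :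
    Nonempty (Z ≃ₗ[Λ] LinearMap.ker (I.cocomplex.d 0 1).hom) :=
  ⟨(I.isLimitKernelFork.conePointUniqueUpToIso
    (ModuleCat.kernelIsLimit (I.cocomplex.d 0 1))).toLinearEquiv⟩

lemma isShortExact_ker_d {Z : ModuleCat.{u} Λ} (I : InjectiveResolution Z) (j : ℕ) :
    ∃ g : I.cocomplex.X j →ₗ[Λ] LinearMap.ker (I.cocomplex.d (j + 1) (j + 2)).hom,
      IsShortExact (A := ModuleCat.of Λ (LinearMap.ker (I.cocomplex.d j (j + 1)).hom))
        (B := I.cocomplex.X j)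
        (C := ModuleCat.of Λ (LinearMap.ker (I.cocomplex.d (j + 1) (j + 2)).hom))
        (LinearMap.ker (I.cocomplex.d j (j + 1)).hom).subtype g := by
  have hex := (ShortComplex.ShortExact.moduleCat_exact_iff_function_exact _).1 (I.exact_succ j)
  exact ⟨_, isShortExact_ker_of_exact hex⟩

/-- The terms of a minimal injective coresolution of `Λ` that are projective are also finitely
generated, so that `DomDimGE` captures the dominant dimension. -/
lemma domDimGE_of_le_dominantDimension [IsNoetherianRing Λ] {d : ℕ}
    (h : ((d + 1 : ℕ) : ℕ∞) ≤ dominantDimension Λ) : DomDimGE (d + 1) (ModuleCat.of Λ Λ) := by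
  obtain ⟨I, hI, hp⟩ := exists_resolution_of_le_dominantDimension h
  obtain ⟨e⟩ := nonempty_equiv_ker_zero I
  have hfin : ∀ j ≤ d + 1, (LinearMap.ker (I.cocomplex.d j (j + 1)).hom).FG := by
    intro j
    induction j with
    | zero =>
      intro _
      have : Module.Finite Λ (ModuleCat.of Λ Λ) := inferInstanceAs (Module.Finite Λ Λ)
      exact Module.Finite.iff_fg.1 (Module.Finite.equiv e)
    | succ j ih =>
      intro hj
      have := hp j (by omega)
      have := finite_of_isEssential (ih (by omega)) (hI j)
      obtain ⟨g, hg⟩ := isShortExact_ker_d I j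
      exact Module.Finite.iff_fg.1 (Module.Finite.of_surjective g hg.surjective)
  have key : ∀ k j, j + k ≤ d + 1 →
      DomDimGE k (ModuleCat.of Λ (LinearMap.ker (I.cocomplex.d j (j + 1)).hom)) := by
    intro k
    induction k with
    | zero => exact fun j _ => domDimGE_zero _
    | succ k ih =>
      intro j hj
      have := hp j (by omega)
      have hf := finite_of_isEssential (hfin j (by omega)) (hI j)
      obtain ⟨g, hg⟩ := isShortExact_ker_d I j
      exact .succ ⟨hf, this, (Module.injective_iff_injective_object Λ _).2 (I.injective j)⟩ hg
        (ih (j + 1) (by omega))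
  exact (key (d + 1) 0 (by omega)).of_equiv e

lemma domDimGE_pi {k : ℕ} (h : DomDimGE k (ModuleCat.of Λ Λ)) (m : ℕ) :
    DomDimGE k (ModuleCat.of Λ (Fin m → Λ)) := by
  induction m with
  | zero => exact .of_subsingleton k _
  | succ m ih =>
    refine DomDimGE.of_equiv (X := ModuleCat.of Λ (Λ × (Fin m → Λ)))
      (Fin.consLinearEquiv Λ fun _ : Fin (m + 1) => Λ).symm ?_
    exact DomDimGE.extension (isShortExact_prod (ModuleCat.of Λ Λ) (ModuleCat.of Λ (Fin m → Λ)))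
      h ih

/-- Finitely generated projective modules have at least the dominant dimension of the regular
module: if `P ⊕ P' = Λᵐ ⊆ Q`, then `Q / P` is an extension of `Q / Λᵐ` by `P'`. -/
lemma domDimGE_of_projective {k : ℕ} (h : DomDimGE k (ModuleCat.of Λ Λ)) (P : ModuleCat.{u} Λ)
    [Module.Finite Λ P] [Module.Projective Λ P] : DomDimGE k P := by
  induction k generalizing P with
  | zero => exact domDimGE_zero P
  | succ k ih =>
    obtain ⟨m, f, g, hf, hg, hfg⟩ := Module.Finite.exists_comp_eq_id_of_projective Λ P
    let P' := ModuleCat.of Λ ((Fin m → Λ) ⧸ LinearMap.range g)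
    have hse : IsShortExact (A := P) (B := ModuleCat.of Λ (Fin m → Λ)) (C := P') g
      (LinearMap.range g).mkQ := isShortExact_of_injective (A := P) (B := Fin m → Λ) hg
    have hs : ∃ s : P' →ₗ[Λ] (Fin m → Λ), (LinearMap.range g).mkQ ∘ₗ s = LinearMap.id := by
      refine (((hse.exact.split_tfae hse.injective hse.surjective).out 1 0).1 ?_)
      exact ⟨f, hfg⟩
    obtain ⟨s, hs⟩ := hs
    have : Module.Projective Λ P' := Module.Projective.of_split s _ hs
    have : Module.Finite Λ P' := Module.Finite.of_surjective _ hse.surjective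
    exact DomDimGE.kernel hse (domDimGE_pi h m) (ih h.of_succ P')

lemma isShortExact_ker_of_isTotallyAcyclic {P : CochainComplex (ModuleCat.{u} Λ) ℤ}
    (hP : IsTotallyAcyclic P) (i : ℤ) :
    ∃ g : P.X i →ₗ[Λ] LinearMap.ker (P.d (i + 1) (i + 1 + 1)).hom,
      IsShortExact (A := ModuleCat.of Λ (LinearMap.ker (P.d i (i + 1)).hom))
        (B := P.X i) (C := ModuleCat.of Λ (LinearMap.ker (P.d (i + 1) (i + 1 + 1)).hom))
        (LinearMap.ker (P.d i (i + 1)).hom).subtype g := by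
  have hex := hP.exact i
  rw [show i + 2 = i + 1 + 1 by ring] at hex
  exact ⟨_, isShortExact_ker_of_exact hex⟩

lemma IsGorensteinProjective.domDimGE {k : ℕ} (h : DomDimGE k (ModuleCat.of Λ Λ))
    {G : ModuleCat.{u} Λ} (hG : IsGorensteinProjective G) : DomDimGE k G := by
  obtain ⟨P, hP, ⟨e⟩⟩ := hG
  have key : ∀ i : ℤ, DomDimGE k (ModuleCat.of Λ (LinearMap.ker (P.d i (i + 1)).hom)) := by
    induction k with
    | zero => exact fun i => domDimGE_zero _
    | succ k ih =>
      intro i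
      obtain ⟨g, hg⟩ := isShortExact_ker_of_isTotallyAcyclic hP i
      have := hP.finite i
      have := hP.projective i
      exact DomDimGE.kernel hg (domDimGE_of_projective h (P.X i)) (ih h.of_succ (i + 1))
  exact (key 0).of_equiv e

end Algebra

/-! ### Resolutions by Gorenstein projective modules -/

section Resolutions

variable {Λ : Type u} [Ring Λ]

lemma HasGorensteinProjectiveResolution.of_zero {M : ModuleCat.{u} Λ}
    (h : HasGorensteinProjectiveResolution M 0) :
    ∃ G : ModuleCat.{u} Λ, IsGorensteinProjective G ∧ Nonempty (M ≃ₗ[Λ] G) := by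
  obtain ⟨G, ε, hG, hG', hε, hex, -⟩ := h
  refine ⟨G.X 0, hG 0 le_rfl, ⟨(LinearEquiv.ofBijective ε.hom ⟨?_, hε⟩).symm⟩⟩
  rw [injective_iff_map_eq_zero]
  intro x hx
  obtain ⟨y, rfl⟩ := (hex x).1 hx
  have := hG' 1 one_pos
  rw [Subsingleton.elim y 0, map_zero]

lemma HasGorensteinProjectiveResolution.exists_syzygy {M : ModuleCat.{u} Λ} {m : ℕ}
    (h : HasGorensteinProjectiveResolution M (m + 1)) :
    ∃ (K G : ModuleCat.{u} Λ) (f : K →ₗ[Λ] G) (g : G →ₗ[Λ] M), IsShortExact f g ∧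
      IsGorensteinProjective G ∧ HasGorensteinProjectiveResolution K m := by
  obtain ⟨G, ε, hG, hG', hε, hex, hex'⟩ := h
  refine ⟨ModuleCat.of Λ (LinearMap.ker ε.hom), G.X 0, (LinearMap.ker ε.hom).subtype, ε.hom,
    isShortExact_of_surjective hε, hG 0 (Nat.zero_le _), ChainComplex.truncate.obj G,
    ModuleCat.ofHom ((G.d 1 0).hom.codRestrict _ fun x => (hex _).2 ⟨x, rfl⟩),
    fun i hi => hG (i + 1) (by omega), fun i hi => hG' (i + 1) (by omega), fun y => ?_, fun x => ?_,
    fun i => hex' (i + 1)⟩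
  · obtain ⟨x, hx⟩ := (hex y).1 y.2
    exact ⟨x, Subtype.ext hx⟩
  · exact Subtype.ext_iff.trans (hex' 0 x)

lemma HasGorensteinProjectiveResolution.of_isShortExact {K G M : ModuleCat.{u} Λ} {m : ℕ}
    {f : K →ₗ[Λ] G} {g : G →ₗ[Λ] M} (h : IsShortExact f g) (hG : IsGorensteinProjective G)
    (hK : HasGorensteinProjectiveResolution K m) : HasGorensteinProjectiveResolution M (m + 1) := by
  obtain ⟨H, ε, hH, hH', hε, hex, hex'⟩ := hK
  have hw : H.d 1 0 ≫ ε ≫ ModuleCat.ofHom f = 0 := by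
    ext x
    have : ε.hom ((H.d 1 0).hom x) = 0 := (hex _).2 ⟨x, rfl⟩
    change f (ε.hom ((H.d 1 0).hom x)) = 0
    rw [this, map_zero]
  refine ⟨H.augment (ε ≫ ModuleCat.ofHom f) hw, ModuleCat.ofHom g, ?_, ?_, h.surjective, ?_, ?_⟩
  · rintro (_ | i) hi
    · exact hG
    · exact hH i (by omega)
  · rintro (_ | i) hi
    · omega
    · exact hH' i (by omega)
  · intro x
    change g x = 0 ↔ ∃ y, f (ε.hom y) = x
    rw [h.exact x]
    constructor
    · rintro ⟨y, rfl⟩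
      obtain ⟨z, rfl⟩ := hε y
      exact ⟨z, rfl⟩
    · rintro ⟨z, rfl⟩
      exact ⟨_, rfl⟩
  · rintro (_ | i)
    · intro x
      change f (ε.hom x) = 0 ↔ _
      rw [map_eq_zero_iff f h.injective]
      exact hex x
    · exact hex' i

lemma HasGorensteinProjectiveResolution.of_isGorensteinProjective {M : ModuleCat.{u} Λ}
    (hM : IsGorensteinProjective M) : HasGorensteinProjectiveResolution M 0 := by
  let H : ChainComplex (ModuleCat.{u} Λ) ℕ :=
    { X := fun _ => ModuleCat.of Λ PUnit, d := fun _ _ => 0 }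
  refine ⟨H.augment (0 : _ ⟶ M) (by simp), 𝟙 M, ?_, ?_, fun x => ⟨x, rfl⟩, ?_, ?_⟩
  · intro i hi
    obtain rfl : i = 0 := by omega
    exact hM
  · rintro (_ | i) hi
    · omega
    · exact inferInstanceAs (Subsingleton PUnit)
  · intro x
    change x = 0 ↔ ∃ y, (0 : M) = x
    exact ⟨fun h => ⟨0, h.symm⟩, fun ⟨_, h⟩ => h.symm⟩
  · intro i x
    exact ⟨fun _ => ⟨0, rfl⟩, fun _ => by cases i <;> rfl⟩

lemma exists_resolution_of_gpd_le {M : ModuleCat.{u} Λ} {n : ℕ} (h : gpd M ≤ (n : ℕ∞)) :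
    ∃ m ≤ n, HasGorensteinProjectiveResolution M m := by
  have hne : {x : ℕ∞ | ∃ m : ℕ, x = (m : ℕ∞) ∧ HasGorensteinProjectiveResolution M m}.Nonempty := by
    by_contra hemp
    rw [Set.not_nonempty_iff_eq_empty] at hemp
    rw [gpd, hemp, sInf_empty] at h
    exact absurd (top_le_iff.1 h) (ENat.natCast_ne_top n)
  obtain ⟨m, hm, hres⟩ := csInf_mem hne
  exact ⟨m, by rw [gpd, hm] at h; exact_mod_cast h, hres⟩

lemma gpd_le {M : ModuleCat.{u} Λ} {n : ℕ} (h : HasGorensteinProjectiveResolution M n) :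
    gpd M ≤ (n : ℕ∞) :=
  sInf_le ⟨n, rfl, h⟩

/-- Each step of a resolution by Gorenstein projective modules lowers the dominant dimension by at
most one. -/
lemma HasGorensteinProjectiveResolution.domDimGE {m k : ℕ}
    (h : DomDimGE (k + m) (ModuleCat.of Λ Λ)) {M : ModuleCat.{u} Λ}
    (hM : HasGorensteinProjectiveResolution M m) : DomDimGE k M := by
  induction m generalizing k M with
  | zero =>
    obtain ⟨G, hG, ⟨e⟩⟩ := hM.of_zero
    exact (hG.domDimGE h).of_equiv e
  | succ m ih =>
    obtain ⟨K, G, f, g, hfg, hG, hK⟩ := hM.exists_syzygy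
    exact DomDimGE.cokernel hfg (ih (k := k + 1) (by rwa [Nat.add_right_comm, Nat.add_assoc]) hK)
      (hG.domDimGE (h.mono (Nat.le_add_right _ _)))

lemma isCogeneratedByFree_of_gpd_le {n : ℕ} (h : DomDimGE (n + 1) (ModuleCat.of Λ Λ))
    {M : ModuleCat.{u} Λ} (hM : gpd M ≤ (n : ℕ∞)) : IsCogeneratedByFree M := by
  obtain ⟨m, hmn, hres⟩ := exists_resolution_of_gpd_le hM
  exact (hres.domDimGE (k := 1) (h.mono (by omega))).isCogeneratedByFree

end Resolutions

/-! ### Fitting decompositions and covers of simple modules -/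

section Fitting

variable {Λ : Type u} [Ring Λ]

/-- `X` is (isomorphic to) a direct summand of `Y`. -/
def IsRetractOf (X Y : ModuleCat.{u} Λ) : Prop :=
  ∃ (s : X →ₗ[Λ] Y) (r : Y →ₗ[Λ] X), r ∘ₗ s = LinearMap.id

lemma IsRetractOf.finite {X Y : ModuleCat.{u} Λ} (h : IsRetractOf X Y) [Module.Finite Λ Y] :
    Module.Finite Λ X := by
  obtain ⟨s, r, hr⟩ := h
  exact Module.Finite.of_surjective r fun x => ⟨s x, LinearMap.congr_fun hr x⟩

lemma IsRetractOf.projective {X Y : ModuleCat.{u} Λ} (h : IsRetractOf X Y)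
    [Module.Projective Λ Y] : Module.Projective Λ X := by
  obtain ⟨s, r, hr⟩ := h
  exact Module.Projective.of_split s r hr

/-- Fitting's lemma: the range of a high power of an endomorphism is a direct summand, on which the
power is injective. -/
lemma exists_fitting {M : Type u} [AddCommGroup M] [Module Λ M] [IsNoetherian Λ M]
    [IsArtinian Λ M] (g : Module.End Λ M) :
    ∃ N : ℕ, (∃ r : M →ₗ[Λ] LinearMap.range (g ^ (N + 1)),
      r ∘ₗ (LinearMap.range (g ^ (N + 1))).subtype = LinearMap.id) ∧
      ∀ x ∈ LinearMap.range (g ^ (N + 1)), (g ^ (N + 1)) x = 0 → x = 0 := by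
  obtain ⟨N, hN⟩ := Filter.eventually_atTop.1 g.eventually_isCompl_ker_pow_range_pow
  have h := hN (N + 1) (Nat.le_succ N)
  refine ⟨N, ⟨_, Submodule.projectionOnto_comp_subtype h.symm⟩, fun x hx hx0 => ?_⟩
  exact (Submodule.mem_bot Λ).1 (h.disjoint.le_bot ⟨hx0, hx⟩)

lemma pow_apply_eq_self {M : Type u} [AddCommGroup M] [Module Λ M] {g : Module.End Λ M} {x : M}
    (h : g x = x) (N : ℕ) : (g ^ N) x = x := by
  induction N with
  | zero => rfl
  | succ N ih => rw [pow_succ, Module.End.mul_apply, h, ih]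

/-- If two maps between finite length modules compose to the identity on the image of `U`, then
the modules have a common direct summand containing `U`. -/
lemma exists_common_retract {U C C' : ModuleCat.{u} Λ} [IsNoetherian Λ C] [IsArtinian Λ C]
    (ι : U →ₗ[Λ] C) (hι : Function.Injective ι) (α : C →ₗ[Λ] C') (β : C' →ₗ[Λ] C)
    (h : ∀ x, β (α (ι x)) = ι x) :
    ∃ E : ModuleCat.{u} Λ, IsRetractOf E C ∧ IsRetractOf E C' ∧
      ∃ κ : U →ₗ[Λ] E, Function.Injective κ := by
  let g : Module.End Λ C := β ∘ₗ α
  obtain ⟨N, ⟨r, hr⟩, hinj⟩ := exists_fitting g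
  let i := (LinearMap.range (g ^ (N + 1))).subtype
  have hmem : ∀ x, ι x ∈ LinearMap.range (g ^ (N + 1)) := fun x =>
    ⟨ι x, pow_apply_eq_self (h x) (N + 1)⟩
  -- `b` is the restriction of `g ^ (N + 1)` to its range, where it is bijective.
  let b : LinearMap.range (g ^ (N + 1)) →ₗ[Λ] LinearMap.range (g ^ (N + 1)) :=
    r ∘ₗ (g ^ (N + 1)) ∘ₗ i
  have hb : ∀ x, (b x : C) = (g ^ (N + 1)) x := fun x =>
    congrArg Subtype.val (LinearMap.congr_fun hr ⟨(g ^ (N + 1)) x, x, rfl⟩)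
  have hbinj : Function.Injective b := by
    rw [injective_iff_map_eq_zero]
    intro x hx
    refine Subtype.ext (hinj x x.2 ?_)
    rw [← hb, hx]
    rfl
  have hbbij := IsArtinian.bijective_of_injective_endomorphism b hbinj
  let e := LinearEquiv.ofBijective b hbbij
  refine ⟨ModuleCat.of Λ (LinearMap.range (g ^ (N + 1))), ⟨i, r, hr⟩,
    ⟨α ∘ₗ i, e.symm.toLinearMap ∘ₗ r ∘ₗ (g ^ N) ∘ₗ β, ?_⟩, ι.codRestrict _ hmem,
    fun x y hxy => hι (congrArg Subtype.val hxy)⟩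
  ext x : 1
  have hpow : ∀ y, (g ^ N) (β (α y)) = (g ^ (N + 1)) y := fun y => by
    rw [pow_succ]
    rfl
  have h1 : r ((g ^ N) (β (α (i x)))) = e x := congrArg r (hpow (i x))
  exact (congrArg e.symm h1).trans (e.symm_apply_apply x)

/-- `π : P → S` exhibits the direct summand `P` of the regular module as a projective cover of the
simple module `S`: every submodule of `P` that is not contained in the kernel of `π` is `P`, so that
this kernel is the largest proper submodule. -/
structure IsSimpleCover {P S : ModuleCat.{u} Λ} (π : P →ₗ[Λ] S) : Prop where
  retract : IsRetractOf P (ModuleCat.of Λ Λ)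
  ne_zero : π ≠ 0
  eq_top : ∀ K : Submodule Λ P, (∃ x ∈ K, π x ≠ 0) → K = ⊤

lemma exists_isSimpleCover [IsArtinianRing Λ] (S : ModuleCat.{u} Λ) [IsSimpleModule Λ S] :
    ∃ (P : ModuleCat.{u} Λ) (π : P →ₗ[Λ] S), IsSimpleCover π := by
  -- Choose a smallest direct summand of the regular module with a nonzero map to `S`.
  let T : Set (Submodule Λ Λ) := {K | ∃ (P : ModuleCat.{u} Λ) (s : P →ₗ[Λ] Λ) (r : Λ →ₗ[Λ] P)
    (π : P →ₗ[Λ] S), r ∘ₗ s = LinearMap.id ∧ π ≠ 0 ∧ K = LinearMap.range s}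
  have hT : T.Nonempty := by
    have := IsSimpleModule.nontrivial Λ S
    obtain ⟨x, hx⟩ := exists_ne (0 : S)
    refine ⟨_, ModuleCat.of Λ Λ, LinearMap.id, LinearMap.id, LinearMap.toSpanSingleton Λ S x, rfl,
      fun h => hx ?_, rfl⟩
    simpa using LinearMap.congr_fun h (1 : Λ)
  obtain ⟨_, ⟨P, s, r, π, hrs, hπ, rfl⟩, hmin⟩ := IsArtinian.set_has_minimal T hT
  have hPr : IsRetractOf P (ModuleCat.of Λ Λ) := ⟨s, r, hrs⟩
  have : Module.Finite Λ (ModuleCat.of Λ Λ) := inferInstanceAs (Module.Finite Λ Λ)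
  have : Module.Projective Λ (ModuleCat.of Λ Λ) := inferInstanceAs (Module.Projective Λ Λ)
  have := hPr.finite
  have := hPr.projective
  refine ⟨P, π, hPr, hπ, fun K ⟨x, hxK, hx⟩ => ?_⟩
  -- `π` lifts along the epimorphism `K → S`, which gives an endomorphism `g` of `P` over `S` with
  -- range in `K`; the range of a high power of `g` is a direct summand, so it is `P`.
  have hsurj : Function.Surjective (π ∘ₗ K.subtype) :=
    LinearMap.surjective_of_ne_zero fun h => hx (LinearMap.congr_fun h ⟨x, hxK⟩)
  obtain ⟨h, hh⟩ := Module.projective_lifting_property (π ∘ₗ K.subtype) π hsurj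
  let g : Module.End Λ P := K.subtype ∘ₗ h
  have hg : ∀ y, π (g y) = π y := fun y => LinearMap.congr_fun hh y
  have hgN : ∀ (N : ℕ) y, π ((g ^ N) y) = π y := by
    intro N
    induction N with
    | zero => exact fun y => rfl
    | succ N ih => exact fun y => by rw [pow_succ, Module.End.mul_apply, ih, hg]
  obtain ⟨N, ⟨r', hr'⟩, -⟩ := exists_fitting g
  let E := LinearMap.range (g ^ (N + 1))
  have hE : LinearMap.range (s ∘ₗ E.subtype) ∈ T := by
    refine ⟨ModuleCat.of Λ E, s ∘ₗ E.subtype, r' ∘ₗ r, π ∘ₗ E.subtype, ?_, fun h0 => ?_, rfl⟩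
    · rw [LinearMap.comp_assoc, ← LinearMap.comp_assoc E.subtype s r, hrs, LinearMap.id_comp, hr']
    · refine hx ?_
      rw [← hgN (N + 1)]
      exact LinearMap.congr_fun h0 ⟨(g ^ (N + 1)) x, x, rfl⟩
  have hle : LinearMap.range (s ∘ₗ E.subtype) ≤ LinearMap.range s :=
    LinearMap.range_comp_le_range _ _
  have heq := hle.eq_of_not_lt (hmin _ hE)
  have hsinj : Function.Injective s := fun a b hab => by
    simpa [hab] using (LinearMap.congr_fun hrs a).symm.trans
      ((congrArg r hab).trans (LinearMap.congr_fun hrs b))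
  refine eq_top_iff.2 fun y _ => ?_
  obtain ⟨⟨_, z, rfl⟩, hz⟩ := heq.ge ⟨y, rfl⟩
  have hy : (g ^ (N + 1)) z = y := hsinj hz
  rw [← hy, pow_succ', Module.End.mul_apply]
  exact (h ((g ^ N) z)).2

/-- A module with a simple cover has, up to isomorphism, only one simple quotient. -/
lemma IsSimpleCover.nonempty_equiv {P S S' : ModuleCat.{u} Λ} [IsSimpleModule Λ S]
    [IsSimpleModule Λ S'] {π : P →ₗ[Λ] S} (h : IsSimpleCover π) {π' : P →ₗ[Λ] S'} (hπ' : π' ≠ 0) :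
    Nonempty (S' ≃ₗ[Λ] S) := by
  have hle : LinearMap.ker π' ≤ LinearMap.ker π := by
    intro x hx
    by_contra hx0
    exact hπ' (LinearMap.ker_eq_top.1 (h.eq_top _ ⟨x, hx, hx0⟩))
  let e := LinearMap.quotKerEquivOfSurjective π' (LinearMap.surjective_of_ne_zero hπ')
  let q := (LinearMap.ker π').liftQ π hle
  have hq : q ∘ₗ e.symm.toLinearMap ≠ 0 := by
    intro h0
    refine h.ne_zero (LinearMap.ext fun x => ?_)
    have := LinearMap.congr_fun h0 (e (Submodule.Quotient.mk x))
    simpa [q] using this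
  exact ⟨LinearEquiv.ofBijective _ (LinearMap.bijective_of_ne_zero hq)⟩

/-- A nonzero direct summand of a module with a simple cover is not killed by the cover. -/
lemma IsSimpleCover.comp_ne_zero_of_retract {P S E : ModuleCat.{u} Λ} [IsSimpleModule Λ S]
    {π : P →ₗ[Λ] S} (h : IsSimpleCover π) {s : E →ₗ[Λ] P} {r : P →ₗ[Λ] E}
    (hrs : r ∘ₗ s = LinearMap.id) [Nontrivial E] : π ∘ₗ s ≠ 0 := by
  intro h0
  obtain ⟨e, he⟩ := exists_ne (0 : E)
  obtain ⟨x, hx⟩ : ∃ x, π x ≠ 0 := by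
    by_contra! hcon
    exact h.ne_zero (LinearMap.ext hcon)
  -- The complementary idempotent `1 - s r` is nonzero modulo the kernel of `π`, so it is onto.
  have htop := h.eq_top (LinearMap.range (LinearMap.id - s ∘ₗ r)) ⟨_, ⟨x, rfl⟩, by
    have := LinearMap.congr_fun h0 (r x)
    simp only [LinearMap.comp_apply, LinearMap.zero_apply] at this
    simpa [this] using hx⟩
  obtain ⟨y, hy⟩ := LinearMap.range_eq_top.1 htop (s e)
  refine he ?_
  rw [← LinearMap.id_apply (R := Λ) e, ← hrs, LinearMap.comp_apply, ← hy]
  have := LinearMap.congr_fun hrs (r y)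
  simp only [LinearMap.comp_apply, LinearMap.id_apply] at this
  simp [this]

end Fitting

/-! ### Matching simple modules with simple modules -/

section Finiteness

variable {Λ : Type u} [Ring Λ]

lemma ExtVanishes.of_subsingleton_right (i : ℕ) (W X : ModuleCat.{u} Λ) [Subsingleton X] :
    ExtVanishes i W X := by
  refine extVanishes_of_forall fun e => ?_
  have h : 𝟙 X = 0 := ModuleCat.hom_ext (LinearMap.ext fun x => Subsingleton.elim _ _)
  rw [← e.comp_mk₀_id, h, Abelian.Ext.mk₀_zero, Abelian.Ext.comp_zero]

lemma isFiniteLength_of_finite [IsArtinianRing Λ] (X : Type u) [AddCommGroup X] [Module Λ X]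
    [Module.Finite Λ X] : IsFiniteLength Λ X :=
  isFiniteLength_iff_isNoetherian_isArtinian.2 ⟨inferInstance, inferInstance⟩

lemma extVanishes_of_isFiniteLength {i : ℕ} {W : ModuleCat.{u} Λ}
    (h : ∀ S : ModuleCat.{u} Λ, IsSimpleModule Λ S → ExtVanishes i W S) {X : Type u}
    [AddCommGroup X] [Module Λ X] (hX : IsFiniteLength Λ X) :
    ExtVanishes i W (ModuleCat.of Λ X) := by
  induction hX with
  | of_subsingleton => exact .of_subsingleton_right i W _
  | @of_simple_quotient X _ _ N hN _ ih =>
    exact IsShortExact.right_middle (A := ModuleCat.of Λ N) (B := ModuleCat.of Λ X)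
      (C := ModuleCat.of Λ (X ⧸ N)) (isShortExact_mkQ N) ih (h (ModuleCat.of Λ (X ⧸ N)) ‹_›)

/-- A module of finite length has, up to isomorphism, finitely many simple quotients. -/
lemma exists_simple_quotients_of_isFiniteLength {X : Type u} [AddCommGroup X] [Module Λ X]
    (hX : IsFiniteLength Λ X) :
    ∃ l : List (ModuleCat.{u} Λ), ∀ S : ModuleCat.{u} Λ, IsSimpleModule Λ S →
      ∀ φ : X →ₗ[Λ] S, φ ≠ 0 → ∃ T ∈ l, Nonempty (S ≃ₗ[Λ] T) := by
  induction hX with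
  | of_subsingleton =>
    exact ⟨[], fun S _ φ hφ => absurd (LinearMap.ext fun x => by
      rw [Subsingleton.elim x 0, map_zero, map_zero]) hφ⟩
  | @of_simple_quotient X _ _ N hN _ ih =>
    obtain ⟨l, hl⟩ := ih
    refine ⟨ModuleCat.of Λ (X ⧸ N) :: l, fun S hS φ hφ => ?_⟩
    by_cases hN0 : φ ∘ₗ N.subtype = 0
    · have hle : N ≤ LinearMap.ker φ := fun x hx => LinearMap.congr_fun hN0 ⟨x, hx⟩
      have hq : N.liftQ φ hle ≠ 0 := fun h0 => hφ (LinearMap.ext fun x =>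
        LinearMap.congr_fun h0 (Submodule.Quotient.mk x))
      exact ⟨_, List.mem_cons_self,
        ⟨(LinearEquiv.ofBijective _ (LinearMap.bijective_of_ne_zero hq)).symm⟩⟩
    · obtain ⟨T, hT, e⟩ := hl S hS _ hN0
      exact ⟨T, List.mem_cons_of_mem _ hT, e⟩

/-- A left artinian ring has finitely many simple modules up to isomorphism. -/
lemma exists_simple_list [IsArtinianRing Λ] :
    ∃ l : List (ModuleCat.{u} Λ), ∀ S : ModuleCat.{u} Λ, IsSimpleModule Λ S →
      ∃ T ∈ l, Nonempty (S ≃ₗ[Λ] T) := by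
  obtain ⟨l, hl⟩ := exists_simple_quotients_of_isFiniteLength (isFiniteLength_of_finite (Λ := Λ) Λ)
  refine ⟨l, fun S hS => ?_⟩
  have := IsSimpleModule.nontrivial Λ S
  obtain ⟨x, hx⟩ := exists_ne (0 : S)
  refine hl S hS (LinearMap.toSpanSingleton Λ S x) fun h => hx ?_
  simpa using LinearMap.congr_fun h (1 : Λ)

variable (Λ) in
/-- Isomorphism of simple modules. -/
def simpleSetoid : Setoid {S : ModuleCat.{u} Λ // IsSimpleModule Λ S} where
  r S T := Nonempty (S.1 ≃ₗ[Λ] T.1)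
  iseqv := ⟨fun S => ⟨LinearEquiv.refl Λ S.1⟩, fun ⟨e⟩ => ⟨e.symm⟩,
    fun ⟨e⟩ ⟨e'⟩ => ⟨e.trans e'⟩⟩

lemma finite_quotient_simpleSetoid [IsArtinianRing Λ] : Finite (Quotient (simpleSetoid Λ)) := by
  obtain ⟨l, hl⟩ := exists_simple_list (Λ := Λ)
  have hl' : ∀ q : Quotient (simpleSetoid Λ), ∃ i : Fin l.length,
      Nonempty (q.out.1 ≃ₗ[Λ] l.get i) := fun q => by
    obtain ⟨T, hT, e⟩ := hl q.out.1 q.out.2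
    obtain ⟨i, rfl⟩ := List.get_of_mem hT
    exact ⟨i, e⟩
  choose f hf using hl'
  refine Finite.of_injective f fun q q' h => ?_
  rw [← Quotient.out_equiv_out]
  obtain ⟨e⟩ := hf q
  obtain ⟨e'⟩ := hf q'
  rw [← h] at e'
  exact ⟨e.trans e'.symm⟩

/-- The pigeonhole principle for simple modules: a relation between isomorphism classes of simple
modules that is total on the left and injective is total on the right. -/
lemma exists_of_injective_relation [IsArtinianRing Λ]
    (ρ : ModuleCat.{u} Λ → ModuleCat.{u} Λ → Prop)
    (hρ : ∀ {S U U' : ModuleCat.{u} Λ}, Nonempty (U' ≃ₗ[Λ] U) → ρ S U → ρ S U')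
    (htotal : ∀ S : ModuleCat.{u} Λ, IsSimpleModule Λ S → ∃ U : ModuleCat.{u} Λ, IsSimpleModule Λ U ∧ ρ S U)
    (hinj : ∀ S S' U : ModuleCat.{u} Λ, IsSimpleModule Λ S → IsSimpleModule Λ S' →
      IsSimpleModule Λ U → ρ S U → ρ S' U → Nonempty (S ≃ₗ[Λ] S'))
    (U : ModuleCat.{u} Λ) (hU : IsSimpleModule Λ U) :
    ∃ S : ModuleCat.{u} Λ, IsSimpleModule Λ S ∧ ρ S U := by
  have := finite_quotient_simpleSetoid (Λ := Λ)
  choose F hFs hF using htotal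
  let φ : Quotient (simpleSetoid Λ) → Quotient (simpleSetoid Λ) := fun q =>
    Quotient.mk _ ⟨F q.out.1 q.out.2, hFs _ _⟩
  have hφ : Function.Injective φ := by
    intro q q' h
    rw [← Quotient.out_equiv_out]
    have e : Nonempty (F q.out.1 q.out.2 ≃ₗ[Λ] F q'.out.1 q'.out.2) := Quotient.exact h
    exact hinj _ _ _ q.out.2 q'.out.2 (hFs _ _) (hF _ q.out.2) (hρ e (hF _ q'.out.2))
  obtain ⟨q, hq⟩ := Finite.surjective_of_injective hφ (Quotient.mk _ ⟨U, hU⟩)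
  have e : Nonempty (F q.out.1 q.out.2 ≃ₗ[Λ] U) := Quotient.exact hq
  exact ⟨q.out.1, q.out.2, hρ (e.map LinearEquiv.symm) (hF _ q.out.2)⟩

end Finiteness

section Matching

variable {Λ : Type u} [Ring Λ] {n : ℕ}

/-- The relation that matches the top `S` of an indecomposable projective module `P` with a simple
module `U`. If `P` is injective, then `U` is a submodule of `P`. Otherwise, `U` is not cogenerated by
the regular module and is a submodule of the last term of a coresolution
`0 → P → Q⁰ → ⋯ → Qⁿ → C → 0` with `Qʲ` projective-injective and `C` injective. -/
def SimpleMatch (n : ℕ) (S U : ModuleCat.{u} Λ) : Prop :=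
  ∃ (P : ModuleCat.{u} Λ) (π : P →ₗ[Λ] S), IsSimpleCover π ∧
    ((Module.Injective Λ P ∧ ∃ ι : U →ₗ[Λ] P, Function.Injective ι) ∨
      ((∀ φ : U →ₗ[Λ] Λ, φ = 0) ∧ ∃ C : ModuleCat.{u} Λ, IsCosyzygy (n + 1) P C ∧
        Module.Finite Λ C ∧ Module.Injective Λ C ∧ ∃ ι : U →ₗ[Λ] C, Function.Injective ι))

lemma SimpleMatch.of_equiv {S U U' : ModuleCat.{u} Λ} (e : Nonempty (U' ≃ₗ[Λ] U))
    (h : SimpleMatch n S U) : SimpleMatch n S U' := by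
  obtain ⟨e⟩ := e
  obtain ⟨P, π, hπ, ⟨hP, ι, hι⟩ | ⟨hU, C, hC, hfin, hinj, ι, hι⟩⟩ := h
  · exact ⟨P, π, hπ, .inl ⟨hP, ι ∘ₗ e.toLinearMap, hι.comp e.injective⟩⟩
  · refine ⟨P, π, hπ, .inr ⟨fun φ => ?_, C, hC, hfin, hinj, ι ∘ₗ e.toLinearMap,
      hι.comp e.injective⟩⟩
    ext x
    simpa using LinearMap.congr_fun (hU (φ ∘ₗ e.symm.toLinearMap)) (e x)

lemma IsRetractOf.exists_injective {P : ModuleCat.{u} Λ}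
    (h : IsRetractOf P (ModuleCat.of Λ Λ)) :
    ∃ φ : P →ₗ[Λ] Λ, Function.Injective φ := by
  obtain ⟨s, r, hrs⟩ := h
  exact ⟨s, fun a b hab => by
    simpa using (LinearMap.congr_fun hrs a).symm.trans
      ((congrArg r hab).trans (LinearMap.congr_fun hrs b))⟩

lemma IsSimpleCover.finite {P S : ModuleCat.{u} Λ} {π : P →ₗ[Λ] S} (h : IsSimpleCover π) :
    Module.Finite Λ P := by
  have : Module.Finite Λ (ModuleCat.of Λ Λ) := inferInstanceAs (Module.Finite Λ Λ)
  exact h.retract.finite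

lemma IsSimpleCover.projective {P S : ModuleCat.{u} Λ} {π : P →ₗ[Λ] S} (h : IsSimpleCover π) :
    Module.Projective Λ P := by
  have : Module.Projective Λ (ModuleCat.of Λ Λ) := inferInstanceAs (Module.Projective Λ Λ)
  exact h.retract.projective

/-- If `E` is a direct summand of the last term `C` of the coresolution of the indecomposable
projective module `P`, then the simple modules `S` with `Extⁿ⁺¹(E, S) ≠ 0` are isomorphic to the top
of `P`. -/
lemma IsSimpleCover.nonempty_equiv_of_not_extVanishes {P S T E C : ModuleCat.{u} Λ}
    [IsSimpleModule Λ S] [IsSimpleModule Λ T] {π : P →ₗ[Λ] S} (hπ : IsSimpleCover π)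
    (hC : IsCosyzygy (n + 1) P C) (hE : IsRetractOf E C) (hT : ¬ ExtVanishes (n + 1) E T) :
    Nonempty (T ≃ₗ[Λ] S) := by
  obtain ⟨s, r, hrs⟩ := hE
  have h0 : ¬ ExtVanishes 0 P T := fun h0 => hT (by
    have h1 := hC.extVanishes_left h0
    rw [Nat.zero_add] at h1
    exact h1.retract_left hrs)
  rw [extVanishes_zero_iff] at h0
  push Not at h0
  obtain ⟨π', hπ'⟩ := h0
  exact hπ.nonempty_equiv hπ'

variable [IsArtinianRing Λ]

lemma exists_projective_presentation (X : ModuleCat.{u} Λ) [Module.Finite Λ X] :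
    ∃ (K F : ModuleCat.{u} Λ) (f : K →ₗ[Λ] F) (g : F →ₗ[Λ] X), IsShortExact f g ∧
      Module.Finite Λ K ∧ Module.Finite Λ F ∧ Module.Projective Λ F := by
  obtain ⟨m, g, hg⟩ := Module.Finite.exists_fin' Λ X
  exact ⟨ModuleCat.of Λ (LinearMap.ker g), ModuleCat.of Λ (Fin m → Λ), (LinearMap.ker g).subtype, g,
    isShortExact_of_surjective hg, inferInstanceAs (Module.Finite Λ (LinearMap.ker g)),
    inferInstanceAs (Module.Finite Λ (Fin m → Λ)),
    inferInstanceAs (Module.Projective Λ (Fin m → Λ))⟩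

/-- A finitely generated module of projective dimension at most `k` has dominant dimension at least
`j` if the regular module has dominant dimension at least `j + k`. -/
lemma domDimGE_of_extVanishes {j k : ℕ} (hΛ : DomDimGE (j + k) (ModuleCat.of Λ Λ))
    (E : ModuleCat.{u} Λ) [Module.Finite Λ E]
    (hE : ∀ X : ModuleCat.{u} Λ, Module.Finite Λ X → ExtVanishes (k + 1) E X) : DomDimGE j E := by
  obtain ⟨K, F, f, g, hfg, hK, hF, hF'⟩ := exists_projective_presentation E
  induction k generalizing j E K F with
  | zero =>
    obtain ⟨s, hs⟩ := hfg.exists_section (hE K hK)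
    have : Module.Projective Λ E := Module.Projective.of_split s g hs
    exact domDimGE_of_projective hΛ E
  | succ k ih =>
    refine DomDimGE.cokernel hfg ?_ (domDimGE_of_projective (hΛ.mono (by omega)) F)
    obtain ⟨K', F', f', g', hfg', hK', hF'', hF'''⟩ := exists_projective_presentation K
    exact ih (j := j + 1) (by rwa [Nat.add_right_comm, Nat.add_assoc]) K
      (fun X hX => hfg.left_first (.of_projective k X) (hE X hX)) K' F' f' g' hfg' hK' hF'' hF'''

lemma exists_simpleMatch (hΛ : DomDimGE (n + 1) (ModuleCat.of Λ Λ))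
    (hid : ∀ W : ModuleCat.{u} Λ, ExtVanishes (n + 2) W (ModuleCat.of Λ Λ))
    (S : ModuleCat.{u} Λ) (hS : IsSimpleModule Λ S) :
    ∃ U : ModuleCat.{u} Λ, IsSimpleModule Λ U ∧ SimpleMatch n S U := by
  obtain ⟨P, π, hπ⟩ := exists_isSimpleCover S
  have := hπ.finite
  have := hπ.projective
  by_cases hPinj : Module.Injective Λ P
  · obtain hbot | ⟨U, hU, -⟩ := IsAtomic.eq_bot_or_exists_atom_le (⊤ : Submodule Λ P)
    · refine absurd (LinearMap.ext fun x => ?_) hπ.ne_zero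
      rw [(Submodule.mem_bot Λ).1 (hbot.le (Submodule.mem_top : x ∈ _)), map_zero, map_zero]
    · exact ⟨ModuleCat.of Λ U, isSimpleModule_iff_isAtom.2 hU, P, π, hπ,
        .inl ⟨hPinj, U.subtype, U.injective_subtype⟩⟩
  · obtain ⟨C, hC⟩ := domDimGE_of_projective hΛ P
    have hCfin := hC.finite ‹_›
    have hCinj : Module.Injective Λ C := hC.injective fun W => by
      obtain ⟨s, r, hrs⟩ := hπ.retract
      exact (hid W).retract_right hrs
    -- If all simple submodules of `C` were cogenerated by `Λ`, then `C` would be a direct summand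
    -- of some `Λᵐ`, and the coresolution of `P` would split.
    by_contra! hcon
    have hcog : IsCogeneratedByFree C := by
      refine isCogeneratedByFree_of_simple (hΛ.mono (by omega)) fun U hU => ?_
      by_contra! hU0
      exact hcon (ModuleCat.of Λ U) hU ⟨P, π, hπ, .inr ⟨hU0, C, hC, hCfin, hCinj, U.subtype,
        U.injective_subtype⟩⟩
    obtain ⟨m, f, hf⟩ := hcog
    obtain ⟨r, hr⟩ := exists_extension_of_injective (A := C) (B := ModuleCat.of Λ (Fin m → Λ))
      hCinj (f := f) hf LinearMap.id
    have : Module.Projective Λ (ModuleCat.of Λ (Fin m → Λ)) :=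
      inferInstanceAs (Module.Projective Λ (Fin m → Λ))
    have hCproj : Module.Projective Λ C :=
      IsRetractOf.projective (Y := ModuleCat.of Λ (Fin m → Λ)) ⟨f, r, LinearMap.ext hr⟩
    exact hPinj (hC.injective_of_projective hCinj hCproj).1

lemma SimpleMatch.nonempty_equiv (hΛ : DomDimGE (n + 1) (ModuleCat.of Λ Λ))
    (S S' U : ModuleCat.{u} Λ) (hS : IsSimpleModule Λ S) (hS' : IsSimpleModule Λ S')
    (hU : IsSimpleModule Λ U) (h : SimpleMatch n S U) (h' : SimpleMatch n S' U) :
    Nonempty (S ≃ₗ[Λ] S') := by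
  have hnt := IsSimpleModule.nontrivial Λ U
  obtain ⟨P, π, hπ, hcase⟩ := h
  obtain ⟨P', π', hπ', hcase'⟩ := h'
  have := hπ.finite
  -- A simple submodule of a projective module is cogenerated by the regular module.
  have hmixed : ∀ {P₀ S₀ : ModuleCat.{u} Λ} {π₀ : P₀ →ₗ[Λ] S₀} (_ : IsSimpleCover π₀)
      (ι : U →ₗ[Λ] P₀), Function.Injective ι → ¬ ∀ φ : U →ₗ[Λ] Λ, φ = 0 := by
    intro P₀ S₀ π₀ hπ₀ ι hι h0
    obtain ⟨φ, hφ⟩ := hπ₀.retract.exists_injective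
    obtain ⟨x, hx⟩ := exists_ne (0 : U)
    exact hx ((hφ.comp hι) ((LinearMap.congr_fun (h0 (φ ∘ₗ ι)) x).trans
      (map_zero (φ ∘ₗ ι)).symm))
  obtain ⟨hP, ι, hι⟩ | ⟨hU0, C, hC, hfin, hinj, ι, hι⟩ := hcase
  · obtain ⟨hP', ι', hι'⟩ | ⟨hU0, -⟩ := hcase'
    · obtain ⟨α, hα⟩ := exists_extension_of_injective hP' hι ι'
      obtain ⟨β, hβ⟩ := exists_extension_of_injective hP hι' ι
      obtain ⟨E, ⟨s, r, hrs⟩, ⟨s', r', hrs'⟩, κ, hκ⟩ :=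
        exists_common_retract ι hι α β fun x => by rw [hα, hβ]
      have : Nontrivial E := hκ.nontrivial
      -- The composition `P' → E → P → S` is nonzero.
      have hne : π ∘ₗ s ∘ₗ r' ≠ 0 := fun h0 => by
        refine hπ.comp_ne_zero_of_retract hrs (LinearMap.ext fun x => ?_)
        have h1 := LinearMap.congr_fun h0 (s' x)
        have h2 : r' (s' x) = x := LinearMap.congr_fun hrs' x
        simpa [h2] using h1
      exact hπ'.nonempty_equiv hne
    · exact absurd hU0 (hmixed hπ ι hι)
  · obtain ⟨hP', ι', hι'⟩ | ⟨-, C', hC', hfin', hinj', ι', hι'⟩ := hcase'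
    · exact absurd hU0 (hmixed hπ' ι' hι')
    · obtain ⟨α, hα⟩ := exists_extension_of_injective hinj' hι ι'
      obtain ⟨β, hβ⟩ := exists_extension_of_injective hinj hι' ι
      obtain ⟨E, hE, hE', κ, hκ⟩ := exists_common_retract ι hι α β fun x => by rw [hα, hβ]
      have := hE.finite
      -- `E` is not cogenerated by `Λ`, so its projective dimension is larger than `n`, which is
      -- detected by a simple module.
      obtain ⟨T, hT, hTE⟩ : ∃ T : ModuleCat.{u} Λ, IsSimpleModule Λ T ∧
          ¬ ExtVanishes (n + 1) E T := by
        by_contra! hcon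
        have hdd : DomDimGE 1 E := domDimGE_of_extVanishes (k := n)
          (by rwa [Nat.add_comm]) E fun X hX =>
            extVanishes_of_isFiniteLength hcon (isFiniteLength_of_finite (Λ := Λ) X)
        obtain ⟨m, f, hf⟩ := hdd.isCogeneratedByFree
        obtain ⟨x, hx⟩ := exists_ne (0 : U)
        refine hx ((hf.comp hκ) (funext fun i => ?_))
        have h1 := LinearMap.congr_fun (hU0 (LinearMap.proj i ∘ₗ f ∘ₗ κ)) x
        simpa using h1
      obtain ⟨e⟩ := hπ.nonempty_equiv_of_not_extVanishes hC hE hTE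
      obtain ⟨e'⟩ := hπ'.nonempty_equiv_of_not_extVanishes hC' hE' hTE
      exact ⟨e.symm.trans e'⟩

/-- A finitely generated module `W` with `Hom(W, Λ) = 0 = Extⁿ⁺¹(W, Λ)` is zero: a simple quotient of
`W` would have no map to `Λ` nor to the injective modules at the end of the coresolutions of the
indecomposable projective modules, but each simple module is a submodule of one of these. -/
lemma subsingleton_of_extVanishes (hΛ : DomDimGE (n + 1) (ModuleCat.of Λ Λ))
    (hid : ∀ W : ModuleCat.{u} Λ, ExtVanishes (n + 2) W (ModuleCat.of Λ Λ))
    (W : ModuleCat.{u} Λ) [Module.Finite Λ W] (hW : ∀ φ : W →ₗ[Λ] Λ, φ = 0)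
    (hW' : ExtVanishes (n + 1) W (ModuleCat.of Λ Λ)) : Subsingleton W := by
  obtain htop | ⟨K, hK, -⟩ := IsCoatomic.eq_top_or_exists_le_coatom (⊥ : Submodule Λ W)
  · exact ⟨fun x y => by
      rw [(Submodule.mem_bot Λ).1 (htop.ge (Submodule.mem_top : x ∈ _)),
        (Submodule.mem_bot Λ).1 (htop.ge (Submodule.mem_top : y ∈ _))]⟩
  exfalso
  have hU : IsSimpleModule Λ (W ⧸ K) := isSimpleModule_iff_isCoatom.2 hK
  have hzero : ∀ {Y : ModuleCat.{u} Λ} (ι : (W ⧸ K) →ₗ[Λ] Y), Function.Injective ι →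
      ι ∘ₗ K.mkQ ≠ 0 := by
    intro Y ι hι h0
    refine hK.1 (eq_top_iff.2 fun x _ => ?_)
    rw [← Submodule.Quotient.mk_eq_zero]
    exact hι ((LinearMap.congr_fun h0 x).trans (map_zero ι).symm)
  obtain ⟨S, hS, P, π, hπ, hcase⟩ := exists_of_injective_relation (SimpleMatch n)
    SimpleMatch.of_equiv (exists_simpleMatch hΛ hid) (SimpleMatch.nonempty_equiv hΛ)
    (ModuleCat.of Λ (W ⧸ K)) hU
  obtain ⟨hP, ι, hι⟩ | ⟨hU0, C, hC, hfin, hinj, ι, hι⟩ := hcase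
  · obtain ⟨φ, hφ⟩ := hπ.retract.exists_injective
    exact hzero (Y := ModuleCat.of Λ Λ) (φ ∘ₗ ι) (hφ.comp hι) (hW _)
  · have h0 : ExtVanishes 0 W C := by
      refine hC.extVanishes_zero (fun Q hQ => extVanishes_zero_iff.2 fun f => ?_) ?_
      · ext x
        by_contra hx
        obtain ⟨φ, hφ⟩ := exists_map_ne_zero_of_projective (Λ := Λ) hx
        exact hφ (LinearMap.congr_fun (hW (φ ∘ₗ f)) x)
      · obtain ⟨s, r, hrs⟩ := hπ.retract
        exact hW'.retract_right hrs
    exact hzero ι hι (extVanishes_zero_iff.1 h0 _)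

end Matching

/-! ### Gorenstein projective modules as the left orthogonal of the regular module -/

section Orthogonal

variable {Λ : Type u} [Ring Λ]

/-- A finitely generated module `X` with `Extⁱ(X, Λ) = 0` for all `i > 0`. -/
structure IsOrthogonal (X : ModuleCat.{u} Λ) : Prop where
  finite : Module.Finite Λ X
  extVanishes : ∀ i : ℕ, ExtVanishes (i + 1) X (ModuleCat.of Λ Λ)

lemma exists_cokernel {A B : ModuleCat.{u} Λ} {f : A →ₗ[Λ] B} (hf : Function.Injective f) :
    ∃ (C : ModuleCat.{u} Λ) (g : B →ₗ[Λ] C), IsShortExact f g :=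
  ⟨ModuleCat.of Λ (B ⧸ LinearMap.range f), (LinearMap.range f).mkQ, isShortExact_of_injective hf⟩

lemma IsOrthogonal.of_projective {P : ModuleCat.{u} Λ} [hP : Module.Finite Λ P]
    [Module.Projective Λ P] : IsOrthogonal P :=
  ⟨hP, fun i => .of_projective i _⟩

/-- Over an Artin algebra, a finitely generated module has a left approximation by a finite free
module, as its dual is finitely generated over the base ring. -/
lemma exists_left_approximation {R : Type v} [CommRing R] [IsArtinianRing R] [Algebra R Λ]
    [Module.Finite R Λ] (X : ModuleCat.{u} Λ) [Module.Finite Λ X] :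
    ∃ (F : ModuleCat.{u} Λ) (f : X →ₗ[Λ] F), Module.Finite Λ F ∧ Module.Projective Λ F ∧
      ∀ φ : X →ₗ[Λ] Λ, ∃ ψ : F →ₗ[Λ] Λ, ψ ∘ₗ f = φ := by
  obtain ⟨k, x, hx⟩ := Module.Finite.exists_fin (R := Λ) (M := X)
  let ev : (X →ₗ[Λ] Λ) →ₗ[R] (Fin k → Λ) :=
    { toFun := fun φ i => φ (x i)
      map_add' := fun _ _ => rfl
      map_smul' := fun _ _ => rfl }
  have hev : Function.Injective ev := fun φ ψ h =>
    LinearMap.ext_on_range hx fun i => congrFun h i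
  have : Module.Finite R (X →ₗ[Λ] Λ) := Module.Finite.of_injective ev hev
  obtain ⟨m, s, hs⟩ := Module.Finite.exists_fin (R := R) (M := X →ₗ[Λ] Λ)
  refine ⟨ModuleCat.of Λ (Fin m → Λ), LinearMap.pi s,
    inferInstanceAs (Module.Finite Λ (Fin m → Λ)),
    inferInstanceAs (Module.Projective Λ (Fin m → Λ)), fun φ => ?_⟩
  have hφ : φ ∈ Submodule.span R (Set.range s) := hs ▸ Submodule.mem_top
  induction hφ using Submodule.span_induction with
  | mem φ h =>
    obtain ⟨i, rfl⟩ := h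
    exact ⟨LinearMap.proj i, LinearMap.proj_pi s i⟩
  | zero => exact ⟨0, LinearMap.zero_comp _⟩
  | add φ φ' _ _ h h' =>
    obtain ⟨ψ, rfl⟩ := h
    obtain ⟨ψ', rfl⟩ := h'
    exact ⟨(ψ + ψ' : (Fin m → Λ) →ₗ[Λ] Λ), LinearMap.add_comp _ _ _⟩
  | smul a φ _ h =>
    obtain ⟨ψ, rfl⟩ := h
    exact ⟨(a • ψ : (Fin m → Λ) →ₗ[Λ] Λ), LinearMap.smul_comp _ _ _⟩

/-- `A` is a syzygy of `B`, that is, `B` is a cosyzygy of `A`. -/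
def IsSyzygy (A B : ModuleCat.{u} Λ) : Prop :=
  ∃ (F : ModuleCat.{u} Λ) (f : A →ₗ[Λ] F) (g : F →ₗ[Λ] B),
    IsShortExact f g ∧ Module.Finite Λ F ∧ Module.Projective Λ F

/-- If every orthogonal module has an orthogonal syzygy and an orthogonal cosyzygy, then iterating
both embeds it in a doubly infinite sequence of such modules. -/
lemma exists_int_sequence (h₁ : ∀ X : ModuleCat.{u} Λ, IsOrthogonal X →
      ∃ K : ModuleCat.{u} Λ, IsOrthogonal K ∧ IsSyzygy K X)
    (h₂ : ∀ X : ModuleCat.{u} Λ, IsOrthogonal X →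
      ∃ Y : ModuleCat.{u} Λ, IsOrthogonal Y ∧ IsSyzygy X Y)
    (X : ModuleCat.{u} Λ) (hX : IsOrthogonal X) :
    ∃ Z : ℤ → ModuleCat.{u} Λ, Z 0 = X ∧ (∀ i, IsOrthogonal (Z i)) ∧
      ∀ i, IsSyzygy (Z i) (Z (i + 1)) := by
  let T := {X : ModuleCat.{u} Λ // IsOrthogonal X}
  have h₁' : ∀ X : T, ∃ K : T, IsSyzygy K.1 X.1 := fun X =>
    let ⟨K, hK, h⟩ := h₁ X.1 X.2
    ⟨⟨K, hK⟩, h⟩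
  have h₂' : ∀ X : T, ∃ Y : T, IsSyzygy X.1 Y.1 := fun X =>
    let ⟨Y, hY, h⟩ := h₂ X.1 X.2
    ⟨⟨Y, hY⟩, h⟩
  choose down hdown using h₁'
  choose up hup using h₂'
  let Z : ℤ → T
    | Int.ofNat k => up^[k] ⟨X, hX⟩
    | Int.negSucc k => down^[k + 1] ⟨X, hX⟩
  refine ⟨fun i => (Z i).1, rfl, fun i => (Z i).2, ?_⟩
  rintro (k | _ | k)
  · change IsSyzygy (up^[k] ⟨X, hX⟩).1 (up^[k + 1] ⟨X, hX⟩).1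
    rw [Function.iterate_succ_apply']
    exact hup _
  · exact hdown ⟨X, hX⟩
  · change IsSyzygy (down^[k + 1 + 1] ⟨X, hX⟩).1 (down^[k + 1] ⟨X, hX⟩).1
    rw [Function.iterate_succ_apply' down (k + 1)]
    exact hdown _

lemma isGorensteinProjective_of_int_sequence {Z : ℤ → ModuleCat.{u} Λ}
    (hZ : ∀ i, IsOrthogonal (Z i)) (hsyz : ∀ i, IsSyzygy (Z i) (Z (i + 1))) :
    IsGorensteinProjective (Z 0) := by
  choose F f g hfg hF hF' using hsyz
  let d : ∀ i, F i ⟶ F (i + 1) := fun i => ModuleCat.ofHom (f (i + 1) ∘ₗ g i)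
  have hgf : ∀ i x, g i (f i x) = 0 := fun i x => (hfg i).exact.apply_apply_eq_zero x
  have hd : ∀ i, d i ≫ d (i + 1) = 0 := fun i => by
    ext x
    change f (i + 1 + 1) (g (i + 1) (f (i + 1) (g i x))) = 0
    rw [hgf, map_zero]
  let P : CochainComplex (ModuleCat.{u} Λ) ℤ := CochainComplex.of F d hd
  have hPd : ∀ i, (P.d i (i + 1)).hom = f (i + 1) ∘ₗ g i := fun i =>
    congrArg ModuleCat.Hom.hom (CochainComplex.of_d F d i)
  refine ⟨P, ⟨hF, hF', fun i => ?_, fun i => ?_⟩, ?_⟩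
  · rw [show i + 2 = i + 1 + 1 by ring, hPd, hPd]
    intro y
    change f (i + 1 + 1) (g (i + 1) y) = 0 ↔ ∃ x, f (i + 1) (g i x) = y
    rw [map_eq_zero_iff _ (hfg (i + 1 + 1)).injective, (hfg (i + 1)).exact y]
    constructor
    · rintro ⟨z, rfl⟩
      obtain ⟨x, rfl⟩ := (hfg i).surjective z
      exact ⟨x, rfl⟩
    · rintro ⟨x, rfl⟩
      exact ⟨_, rfl⟩
  · rw [show i + 2 = i + 1 + 1 by ring, hPd, hPd]
    intro φ
    constructor
    · intro hφ
      -- `φ` kills the image of `Z (i + 1)`, so it factors through `Z (i + 2)`, and the factor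
      -- extends along `Z (i + 2) → F (i + 2)`.
      have hker : LinearMap.ker (g (i + 1)) ≤ LinearMap.ker φ := by
        intro y hy
        obtain ⟨z, rfl⟩ := ((hfg (i + 1)).exact y).1 hy
        obtain ⟨x, rfl⟩ := (hfg i).surjective z
        exact LinearMap.congr_fun hφ x
      let e := (g (i + 1)).quotKerEquivOfSurjective (hfg (i + 1)).surjective
      let χ : Z (i + 1 + 1) →ₗ[Λ] Λ := (LinearMap.ker (g (i + 1))).liftQ φ hker ∘ₗ e.symm.toLinearMap
      obtain ⟨ψ, hψ⟩ := (hfg (i + 1 + 1)).exists_extension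
        ((hZ (i + 1 + 1 + 1)).extVanishes 0) χ
      refine ⟨ψ, LinearMap.ext fun y => ?_⟩
      have h1 : ψ (f (i + 1 + 1) (g (i + 1) y)) = χ (g (i + 1) y) := LinearMap.congr_fun hψ _
      have h2 : e (Submodule.Quotient.mk y) = g (i + 1) y := rfl
      change ψ (f (i + 1 + 1) (g (i + 1) y)) = φ y
      rw [h1, ← h2]
      simp [χ]
    · rintro ⟨ψ, rfl⟩
      ext x
      change ψ (f (i + 1 + 1) (g (i + 1) (f (i + 1) (g i x)))) = 0
      rw [hgf, map_zero, map_zero]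
  · have hker : LinearMap.ker (P.d 0 1).hom = LinearMap.range (f 0) := by
      have h0 : (P.d 0 1).hom = f 1 ∘ₗ g 0 := hPd 0
      rw [h0, LinearMap.ker_comp_of_ker_eq_bot _ (LinearMap.ker_eq_bot.2 (hfg 1).injective)]
      exact LinearMap.exact_iff.1 (hfg 0).exact
    exact ⟨(LinearEquiv.ofInjective (f 0) (hfg 0).injective).trans
      (LinearEquiv.ofEq _ _ hker.symm)⟩

variable [IsArtinianRing Λ] {n : ℕ}

/-- Modules orthogonal to the regular module are cogenerated by it: the intersection `W` of the
kernels of all maps `X → Λ` satisfies `Hom(W, Λ) = 0 = Extⁿ⁺¹(W, Λ)`. -/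
lemma IsOrthogonal.isCogeneratedByFree (hΛ : DomDimGE (n + 1) (ModuleCat.of Λ Λ))
    (hid : ∀ W : ModuleCat.{u} Λ, ExtVanishes (n + 2) W (ModuleCat.of Λ Λ))
    {X : ModuleCat.{u} Λ} (hX : IsOrthogonal X) : IsCogeneratedByFree X := by
  have := hX.finite
  let W : Submodule Λ X := ⨅ φ : X →ₗ[Λ] Λ, LinearMap.ker φ
  have hmem : ∀ x, x ∈ W ↔ ∀ φ : X →ₗ[Λ] Λ, φ x = 0 := fun x => by simp [W]
  have hfin : Module.Finite Λ (ModuleCat.of Λ W) := inferInstanceAs (Module.Finite Λ W)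
  obtain ⟨V, q, hse⟩ := exists_cokernel (A := ModuleCat.of Λ W) (B := X) W.injective_subtype
  obtain ⟨Q, Y, j, _, hQ, hj, _⟩ := (hΛ.mono (Nat.le_add_left 1 n)).exists_succ
  have := hQ.projective
  have hW : Subsingleton (ModuleCat.of Λ W) := by
    refine subsingleton_of_extVanishes hΛ hid (ModuleCat.of Λ W) (fun φ => ?_)
      (hse.left_first (hX.extVanishes n) (hid _))
    obtain ⟨ψ, hψ⟩ := exists_extension_of_injective hQ.injective hse.injective (j ∘ₗ φ)
    ext x
    have h0 : ψ (x : X) = 0 := by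
      by_contra h0
      obtain ⟨χ, hχ⟩ := exists_map_ne_zero_of_projective (Λ := Λ) h0
      exact hχ ((hmem x).1 x.2 (χ ∘ₗ ψ))
    exact hj.injective (((hψ x).symm.trans h0).trans (map_zero j).symm)
  refine isCogeneratedByFree_of_separating fun x hx => ?_
  by_contra! hcon
  exact hx (congrArg Subtype.val (hW.elim (⟨x, (hmem x).2 hcon⟩ : W) 0))

lemma IsOrthogonal.exists_syzygy {X : ModuleCat.{u} Λ} (hX : IsOrthogonal X) :
    ∃ K : ModuleCat.{u} Λ, IsOrthogonal K ∧ IsSyzygy K X := by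
  have := hX.finite
  obtain ⟨K, F, f, g, hfg, hK, hF, hF'⟩ := exists_projective_presentation X
  exact ⟨K, ⟨hK, fun i => hfg.left_first (.of_projective i _) (hX.extVanishes (i + 1))⟩,
    F, f, g, hfg, hF, hF'⟩

lemma IsOrthogonal.exists_cosyzygy {R : Type v} [CommRing R] [IsArtinianRing R] [Algebra R Λ]
    [Module.Finite R Λ] (hΛ : DomDimGE (n + 1) (ModuleCat.of Λ Λ))
    (hid : ∀ W : ModuleCat.{u} Λ, ExtVanishes (n + 2) W (ModuleCat.of Λ Λ))
    {X : ModuleCat.{u} Λ} (hX : IsOrthogonal X) :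
    ∃ Y : ModuleCat.{u} Λ, IsOrthogonal Y ∧ IsSyzygy X Y := by
  have := hX.finite
  obtain ⟨F, f, hF, hF', hf⟩ := exists_left_approximation (R := R) X
  have hinj : Function.Injective f := by
    rw [injective_iff_map_eq_zero]
    intro x hx
    by_contra hx0
    obtain ⟨φ, hφ⟩ := isCogeneratedByFree_iff_separating.1 (hX.isCogeneratedByFree hΛ hid) x hx0
    obtain ⟨ψ, rfl⟩ := hf φ
    exact hφ (by rw [LinearMap.comp_apply, hx, map_zero])
  obtain ⟨Y, g, hse⟩ := exists_cokernel hinj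
  refine ⟨Y, ⟨Module.Finite.of_surjective _ hse.surjective, fun i => ?_⟩, F, f, _, hse, hF, hF'⟩
  cases i with
  | zero => exact hse.extVanishes_one_of_extension (.of_projective 0 _) hf
  | succ i => exact hse.left_last (hX.extVanishes i) (.of_projective (i + 1) _)

lemma IsOrthogonal.isGorensteinProjective {R : Type v} [CommRing R] [IsArtinianRing R]
    [Algebra R Λ] [Module.Finite R Λ] (hΛ : DomDimGE (n + 1) (ModuleCat.of Λ Λ))
    (hid : ∀ W : ModuleCat.{u} Λ, ExtVanishes (n + 2) W (ModuleCat.of Λ Λ))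
    {X : ModuleCat.{u} Λ} (hX : IsOrthogonal X) : IsGorensteinProjective X := by
  obtain ⟨Z, rfl, hZ, hsyz⟩ := exists_int_sequence (fun _ h => h.exists_syzygy)
    (fun _ h => h.exists_cosyzygy (R := R) hΛ hid) X hX
  exact isGorensteinProjective_of_int_sequence hZ hsyz

lemma hasGorensteinProjectiveResolution_of_extVanishes {R : Type v} [CommRing R]
    [IsArtinianRing R] [Algebra R Λ] [Module.Finite R Λ]
    (hΛ : DomDimGE (n + 1) (ModuleCat.of Λ Λ))
    (hid : ∀ W : ModuleCat.{u} Λ, ExtVanishes (n + 2) W (ModuleCat.of Λ Λ))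
    (k : ℕ) (X : ModuleCat.{u} Λ) [Module.Finite Λ X]
    (hX : ∀ i, ExtVanishes (i + k + 1) X (ModuleCat.of Λ Λ)) :
    HasGorensteinProjectiveResolution X k := by
  induction k generalizing X with
  | zero =>
    exact .of_isGorensteinProjective
      (IsOrthogonal.isGorensteinProjective (R := R) hΛ hid ⟨‹_›, hX⟩)
  | succ k ih =>
    obtain ⟨K, F, f, g, hfg, hK, hF, hF'⟩ := exists_projective_presentation X
    refine .of_isShortExact hfg
      (IsOrthogonal.of_projective.isGorensteinProjective (R := R) hΛ hid) (ih K fun i => ?_)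
    exact hfg.left_first (.of_projective (i + k) _) (hX i)

/-- A submodule `N` of `Λᵐ` satisfies `Extⁱ(N, Λ) = Extⁱ⁺¹(Λᵐ / N, Λ) = 0` for `i > n`. -/
lemma gpd_le_of_isCogeneratedByFree {R : Type v} [CommRing R] [IsArtinianRing R] [Algebra R Λ]
    [Module.Finite R Λ] (hΛ : DomDimGE (n + 1) (ModuleCat.of Λ Λ))
    (hid : ∀ i, ∀ W : ModuleCat.{u} Λ, ExtVanishes (n + 2 + i) W (ModuleCat.of Λ Λ))
    {N : ModuleCat.{u} Λ} [Module.Finite Λ N] (hN : IsCogeneratedByFree N) :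
    gpd N ≤ (n : ℕ∞) := by
  obtain ⟨F, hF, f, hf⟩ : ∃ F : ModuleCat.{u} Λ, Module.Projective Λ F ∧
      ∃ f : N →ₗ[Λ] F, Function.Injective f := by
    obtain ⟨m, f, hf⟩ := hN
    exact ⟨ModuleCat.of Λ (Fin m → Λ), inferInstanceAs (Module.Projective Λ (Fin m → Λ)), f, hf⟩
  obtain ⟨C, g, hse⟩ := exists_cokernel hf
  refine gpd_le (hasGorensteinProjectiveResolution_of_extVanishes (R := R) hΛ (hid 0) n N
    fun i => hse.left_first (.of_projective (i + n) _) ?_)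
  have := hid i C
  rwa [show n + 2 + i = i + n + 1 + 1 by omega] at this

end Orthogonal

section Socle

variable {Λ : Type u} [Ring Λ]

/-- Cogeneration by `Λ` passes from the socle to the module, as it is tested on simple
submodules. -/
lemma isCogeneratedByFree_of_soc (hΛ : DomDimGE 1 (ModuleCat.of Λ Λ)) {N : ModuleCat.{u} Λ}
    [IsArtinian Λ N] (h : IsCogeneratedByFree (soc N)) : IsCogeneratedByFree N := by
  obtain ⟨m, f, hf⟩ := h
  refine isCogeneratedByFree_of_simple hΛ fun U hU => ?_
  have hle : U ≤ socle N := le_sSup hU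
  have := IsSimpleModule.nontrivial Λ U
  obtain ⟨x, hx⟩ := exists_ne (0 : U)
  have hfx : f (Submodule.inclusion hle x) ≠ 0 := fun h0 => hx (Submodule.inclusion_injective hle
    ((hf (h0.trans (map_zero f).symm)).trans (map_zero (Submodule.inclusion hle)).symm))
  obtain ⟨i, hi⟩ := Function.ne_iff.1 hfx
  exact ⟨LinearMap.proj i ∘ₗ f ∘ₗ Submodule.inclusion hle, fun h0 => hi (LinearMap.congr_fun h0 x)⟩

end Socle

end AuslanderGorenstein

theorem theorem3p3 {R : Type v} {Λ : Type u} [CommRing R] [IsArtinianRing R] [Ring Λ]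
    [Algebra R Λ] [Module.Finite R Λ] (n : ℕ)
    (hΛ : AuslanderGorenstein.IsMinimalAuslanderGorenstein Λ n) :
    (∀ N : ModuleCat.{u} Λ, Module.Finite Λ N →
      List.TFAE [
        AuslanderGorenstein.gpd N ≤ (n : ℕ∞),
        AuslanderGorenstein.gpd (AuslanderGorenstein.soc N) ≤ (n : ℕ∞),
        AuslanderGorenstein.IsCogeneratedByFree N]) ∧
    AuslanderGorenstein.GPle Λ n =
      {N : ModuleCat.{u} Λ | Module.Finite Λ N ∧
        AuslanderGorenstein.gpd (AuslanderGorenstein.soc N) ≤ (n : ℕ∞)} ∧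
    {N : ModuleCat.{u} Λ | Module.Finite Λ N ∧
        AuslanderGorenstein.gpd (AuslanderGorenstein.soc N) ≤ (n : ℕ∞)} =
      AuslanderGorenstein.subΛ Λ := by
  open AuslanderGorenstein in
  have : IsArtinianRing Λ := IsArtinianRing.of_finite R Λ
  have hdom : DomDimGE (n + 1) (ModuleCat.of Λ Λ) := domDimGE_of_le_dominantDimension hΛ.2
  have hinj : HasInjectiveDimensionLT (ModuleCat.of Λ Λ) (n + 2) :=
    (injectiveDimension_le_iff _ (n + 1)).1 hΛ.1
  have hid : ∀ i, ∀ W : ModuleCat.{u} Λ, ExtVanishes (n + 2 + i) W (ModuleCat.of Λ Λ) :=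
    fun i W => HasInjectiveDimensionLT.subsingleton _ (n + 2) _ (Nat.le_add_right _ _) W
  have hiff : ∀ N : ModuleCat.{u} Λ, Module.Finite Λ N →
      (gpd N ≤ (n : ℕ∞) ↔ IsCogeneratedByFree N) := fun N hN =>
    ⟨isCogeneratedByFree_of_gpd_le hdom, gpd_le_of_isCogeneratedByFree (R := R) hdom hid⟩
  have hsoc : ∀ N : ModuleCat.{u} Λ, Module.Finite Λ N →
      (gpd (soc N) ≤ (n : ℕ∞) ↔ IsCogeneratedByFree N) := fun N hN => by
    rw [hiff (soc N) (inferInstanceAs (Module.Finite Λ (socle N)))]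
    exact ⟨isCogeneratedByFree_of_soc (hdom.mono (Nat.le_add_left 1 n)),
      fun h => isCogeneratedByFree_of_injective h (socle N).subtype (socle N).injective_subtype⟩
  refine ⟨fun N hN => ?_, ?_, ?_⟩
  · tfae_have 1 ↔ 3 := hiff N hN
    tfae_have 2 ↔ 3 := hsoc N hN
    tfae_finish
  · ext N
    exact and_congr_right fun hN => (hiff N hN).trans (hsoc N hN).symm
  · ext N
    exact and_congr_right fun hN => hsoc N hN
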